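/- **Theorem (Asymptotic capacity exactness).** All logarithms are natural. Let $d\ge 2$, $p=d-1$, $\lambda>0$, $u>0$, and let $\mathbf N\in\mathbb R^{p}$ have the $\mathrm{NDFHL}^{(d)}(\lambda,u)$ distribution, i.e. the density $$f_{\mathbf N}(\mathbf n)=\frac{\lambda}{2^{d/2-1}\pi^{d/2}}\Big(\frac{u}{\rho(\mathbf n)}\Big)^{d/2}e^{\lambda u}K_{d/2}(u\rho(\mathbf n)),\qquad \rho(\mathbf n)=\sqrt{\|\mathbf n\|^2+\lambda^2},$$ where $K_\nu$ is the modified Bessel function of the second kind. For the channel $\mathbf Y=\mathbf X+\mathbf N$, $\mathbf X\in\mathbb R^p$ independent of $\mathbf N$, put $$C(P)=\sup_{P_{\mathbf X}:\ \mathbb E\|\mathbf X\|^2\le P} I(\mathbf X;\mathbf X+\mathbf N),\qquad h(\mathbf N)=-\int f_{\mathbf N}\log f_{\mathbf N},\qquad c^*=\frac p2\log\Big(\frac{2\pi e}{p}\Big)-h(\mathbf N).$$ Then $f_{\mathbf N}$ is a probability density, $h(\mathbf N)$ is finite, $C(P)<\infty$ for every $P>0$, and 1. (Capacity expansion) $C(P)=\frac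 p2\log P+c^*+o(1)$ as $P\to\infty$. 2. (Maximum-entropy upper bound) For every $P>0$, $C(P)\le \frac p2\log\!\big(2\pi e(\frac Pp+\frac\lambda u)\big)-h(\mathbf N)$, and this upper bound equals $\frac p2\log P+c^*+o(1)$ as $P\to\infty$. 3. (Gaussian-input lower bound) Let $\sigma>0$, let $T$ have the inverse Gaussian law with mean $\lambda/(u\sigma^2)$ and shape $\lambda^2/\sigma^2$, and let $\mathbf Z\sim\mathcal N(\mathbf 0,\mathbf I_p)$ be independent of $T$. Then $\sigma\sqrt T\,\mathbf Z\sim\mathrm{NDFHL}^{(d)}(\lambda,u)$, and $\mathbb E|\log T|$ and $I(T;\sigma\sqrt T\,\mathbf Z)$ are finite. For every $P>0$ the input $\mathbf X_G\sim\mathcal N(\mathbf 0,\frac Pp\mathbf I_p)$, independent of $\mathbf N$, satisfies $$I(\mathbf X_G;\mathbf X_G+\mathbf N)\ \ge\ \mathbb E\Big[\frac p2\log\Big(1+\frac{P}{p\sigma^2T}\Big)\Big]-I(T;\sigma\sqrt T\,\mathbf Z),$$ where the expectation is finite. As $P\to\infty$ the right-hand side equals $\frac p2\log P+c_{\mathrm{LB}}+o(1)$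 with $$c_{\mathrm{LB}}=\frac p2\log\frac1{p\sigma^2}-\frac p2\mathbb E[\log T]-I(T;\sigma\sqrt T\,\mathbf Z),$$ and $c_{\mathrm{LB}}=c^*$. 4. (Asymptotic optimality of Gaussian signaling) For every $P>0$, $\mathbb E\|\mathbf X_G\|^2=P$ and $I(\mathbf X_G;\mathbf X_G+\mathbf N)<\infty$; moreover $C(P)-I(\mathbf X_G;\mathbf X_G+\mathbf N)\to0$ as $P\to\infty$. -/

import Mathlib

open MeasureTheory ProbabilityTheory Filter Topology
open scoped ENNReal

noncomputable section

namespace NDFHL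

/-- The transverse space: Euclidean space of dimension `d - 1`. -/
abbrev Plane (d : ℕ) : Type := EuclideanSpace ℝ (Fin (d - 1))

/-- The modified Bessel function of the second kind `K_ν(z)` for real `z > 0`, by its classical
integral representation `K_ν(z) = ∫_0^∞ exp (-z cosh t) cosh (ν t) dt`. -/
def besselK (ν z : ℝ) : ℝ :=
  ∫ t in Set.Ioi (0 : ℝ), Real.exp (-(z * Real.cosh t)) * Real.cosh (ν * t)

/-- The density of the Normally-Drifted First-Hitting Location distribution with parameters
`d`, `lam`, `u`; here `ρ(n) = √(‖n‖² + lam²)`. -/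
def pdf (d : ℕ) (lam u : ℝ) (n : Plane d) : ℝ :=
  lam / ((2 : ℝ) ^ ((d : ℝ) / 2 - 1) * Real.pi ^ ((d : ℝ) / 2)) *
    (u / Real.sqrt (‖n‖ ^ 2 + lam ^ 2)) ^ ((d : ℝ) / 2) * Real.exp (lam * u) *
    besselK ((d : ℝ) / 2) (u * Real.sqrt (‖n‖ ^ 2 + lam ^ 2))

/-- The law of the NDFHL noise: the measure with density `pdf d lam u`. -/
def law (d : ℕ) (lam u : ℝ) : Measure (Plane d) :=
  volume.withDensity fun n => ENNReal.ofReal (pdf d lam u n)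

/-- The differential entropy `-∫ f log f`, in nats, of a random vector with density `f`. -/
def differentialEntropy {E : Type*} [MeasureSpace E] (f : E → ℝ) : ℝ :=
  ∫ x, Real.negMulLog (f x)

/-- The mutual information `I(A; B)`, in nats, of a pair `(A, B)` with joint law `ρ`:
the Kullback-Leibler divergence of `ρ` from the product of its marginals. -/
def mutualInfo {α β : Type*} [MeasurableSpace α] [MeasurableSpace β]
    (ρ : Measure (α × β)) : ℝ≥0∞ :=
  InformationTheory.klDiv ρ (ρ.fst.prod ρ.snd)

/-- The mutual information `I(X; X + N)` over the additive noise channel, where `X` has law `μ`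
and the noise `N`, independent of `X`, has law `ν`. -/
def channelInfo {E : Type*} [MeasurableSpace E] [Add E] (ν μ : Measure E) : ℝ≥0∞ :=
  mutualInfo ((μ.prod ν).map fun q => (q.1, q.1 + q.2))

/-- The capacity of the additive noise channel with noise law `ν` under the input constraint
`E‖X‖² ≤ P`: the supremum of `I(X; X + N)` over all admissible input laws. -/
def capacity {E : Type*} [MeasurableSpace E] [NormedAddCommGroup E]
    (ν : Measure E) (P : ℝ) : ℝ≥0∞ :=
  ⨆ (μ : Measure E) (_ : IsProbabilityMeasure μ)
    (_ : ∫⁻ x, ENNReal.ofReal (‖x‖ ^ 2) ∂μ ≤ ENNReal.ofReal P), channelInfo ν μ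

/-- The isotropic centered Gaussian law `𝓝(0, v I)`, as the law of `√v • Z` with `Z` standard
Gaussian. -/
def isotropicGaussian (d : ℕ) (v : ℝ) : Measure (Plane d) :=
  (stdGaussian (Plane d)).map fun z => Real.sqrt v • z

/-- The constant `c* = (p/2) log (2πe/p) - h(N)` with `p = d - 1`. -/
def offset (d : ℕ) (lam u : ℝ) : ℝ :=
  ((d : ℝ) - 1) / 2 * Real.log (2 * Real.pi * Real.exp 1 / ((d : ℝ) - 1)) -
    differentialEntropy (pdf d lam u)

/-- The maximum-entropy bound `(p/2) log (2πe (P/p + lam/u)) - h(N)` with `p = d - 1`. -/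
def maxEntropyBound (d : ℕ) (lam u P : ℝ) : ℝ :=
  ((d : ℝ) - 1) / 2 *
      Real.log (2 * Real.pi * Real.exp 1 * (P / ((d : ℝ) - 1) + lam / u)) -
    differentialEntropy (pdf d lam u)

/-- The inverse Gaussian law `IG(m, κ)` with mean `m` and shape `κ`. -/
def inverseGaussian (m κ : ℝ) : Measure ℝ :=
  (volume.restrict (Set.Ioi 0)).withDensity fun t =>
    ENNReal.ofReal (Real.sqrt (κ / (2 * Real.pi * t ^ 3)) *
      Real.exp (-(κ * (t - m) ^ 2 / (2 * m ^ 2 * t))))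

/-- The law of the hitting time `T` of the level `lam` by a Brownian motion with drift `u σ²` and
diffusion coefficient `σ`, namely `IG(lam / (u σ²), lam² / σ²)`. -/
def hittingTime (lam u σ : ℝ) : Measure ℝ :=
  inverseGaussian (lam / (u * σ ^ 2)) (lam ^ 2 / σ ^ 2)

/-- The joint law of `(T, σ √T Z)`, where `T` is the hitting time and `Z`, independent of `T`, is
a standard Gaussian vector. -/
def mixture (d : ℕ) (lam u σ : ℝ) : Measure (ℝ × Plane d) :=
  ((hittingTime lam u σ).prod (stdGaussian (Plane d))).map
    fun q => (q.1, (σ * Real.sqrt q.1) • q.2)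

/-- The Gaussian-input lower bound obtained by conditioning on the hitting time, with `p = d - 1`:
`E[(p/2) log (1 + P / (p σ² T))] - I(T; N)`. -/
def mixtureBound (d : ℕ) (lam u σ P : ℝ) : ℝ :=
  (∫ t, ((d : ℝ) - 1) / 2 * Real.log (1 + P / (((d : ℝ) - 1) * σ ^ 2 * t))
      ∂(hittingTime lam u σ)) -
    (mutualInfo (mixture d lam u σ)).toReal

/-- The constant term of the lower bound, with `p = d - 1`:
`(p/2) log (1 / (p σ²)) - (p/2) E[log T] - I(T; N)`. -/
def mixtureOffset (d : ℕ) (lam u σ : ℝ) : ℝ :=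
  ((d : ℝ) - 1) / 2 * Real.log (1 / (((d : ℝ) - 1) * σ ^ 2)) -
    ((d : ℝ) - 1) / 2 * (∫ t, Real.log t ∂(hittingTime lam u σ)) -
    (mutualInfo (mixture d lam u σ)).toReal

end NDFHL

end

/-!
The noise is a Gaussian scale mixture: mixing the isotropic Gaussian densities of variance `σ² t`
over the inverse Gaussian law of the hitting time `T` turns the mixing integral into the integral
representation of `K_{d/2}` (`lintegral_gaussianDensity_hittingTime`). Hence the noise law is a
probability law with second moment `p lam / u`, where `p = d - 1`. The logarithm of its density
grows at most quadratically (`exists_abs_log_pdf_le`), so its differential entropy is finite.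

The entropies of the channel outputs are never needed. Every information quantity is compared with
a divergence from a product with a Gaussian law `Q` by the golden formula
`D(P_XY ‖ P_X ⊗ Q) = I(X; Y) + D(P_Y ‖ Q)` (`klDiv_fst_prod_eq_mutualInfo_add`), a form of the
chain rule, and the divergences from Gaussian laws are explicit integrals of log-ratios of densities
(`klDiv_withDensity`).

* Upper bound: discarding `D(P_Y ‖ Q)`, with `Q` of the second moment allowed for the output, is the
  maximum-entropy bound (`IsRegularNoise.toReal_channelInfo_le`).
* Lower bound: for a Gaussian input of variance `v` the output is a marginal of the mixture with
  variances `v + σ² T`, and divergence decreases under marginalization, so that `D(P_Y ‖ Q)` is at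
  most an explicit divergence between mixtures
  (`IsRegularNoise.le_toReal_channelInfo_gaussianLaw`). The golden formula also gives
  `I(T; N) = h(N) - h(N | T)` (`IsRegularNoise.mutualInfo_gaussianMixture`), which identifies the
  bound with `mixtureBound` and its constant term with `offset`.

Both bounds are `(p/2) log P + offset + o(1)`, the lower one by dominated convergence, and they
enclose the information of the Gaussian input and the capacity.
-/

noncomputable section

namespace NDFHL

open InformationTheory

/-! ### Isotropic Gaussian laws -/

section Gaussian

variable {E : Type*} [NormedAddCommGroup E] [InnerProductSpace ℝ E] [FiniteDimensional ℝ E]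
  [MeasurableSpace E] [BorelSpace E]

/-- The density of the centered Gaussian law with covariance `v • 1` on a Euclidean space. It is
meaningful for `v > 0` only. -/
def gaussianDensity (v : ℝ) (x : E) : ℝ :=
  (2 * Real.pi * v) ^ (-((Module.finrank ℝ E : ℝ) / 2)) * Real.exp (-(‖x‖ ^ 2 / (2 * v)))

omit [FiniteDimensional ℝ E] [MeasurableSpace E] [BorelSpace E] in
lemma gaussianDensity_pos {v : ℝ} (hv : 0 < v) (x : E) : 0 < gaussianDensity v x := by
  unfold gaussianDensity; positivity

omit [FiniteDimensional ℝ E] in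
lemma measurable_gaussianDensity : Measurable fun q : ℝ × E => gaussianDensity q.1 q.2 := by
  unfold gaussianDensity; fun_prop

omit [FiniteDimensional ℝ E] [MeasurableSpace E] [BorelSpace E] in
lemma log_gaussianDensity {v : ℝ} (hv : 0 < v) (x : E) :
    Real.log (gaussianDensity v x) =
      -((Module.finrank ℝ E : ℝ) / 2 * Real.log (2 * Real.pi * v)) - ‖x‖ ^ 2 / (2 * v) := by
  have h : 0 < 2 * Real.pi * v := by positivity
  rw [gaussianDensity, Real.log_mul (by positivity) (by positivity), Real.log_rpow h, Real.log_exp]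
  ring

lemma integral_gaussianDensity {v : ℝ} (hv : 0 < v) :
    ∫ x : E, gaussianDensity v x = 1 := by
  have h := GaussianFourier.integral_rexp_neg_mul_sq_norm (V := E) (b := 1 / (2 * v))
    (by positivity)
  have h0 : 0 < 2 * Real.pi * v := by positivity
  unfold gaussianDensity
  rw [integral_const_mul]
  have h1 : ∀ x : E, -(‖x‖ ^ 2 / (2 * v)) = -(1 / (2 * v)) * ‖x‖ ^ 2 := fun x => by ring
  simp_rw [h1]
  rw [h, show Real.pi / (1 / (2 * v)) = 2 * Real.pi * v by field_simp,
    ← Real.rpow_add h0]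
  simp

lemma integrable_gaussianDensity {v : ℝ} (hv : 0 < v) :
    Integrable fun x : E => gaussianDensity v x :=
  not_imp_comm.1 integral_undef (by rw [integral_gaussianDensity hv]; exact one_ne_zero)

/-- The law of `√v • Z` with `Z` standard Gaussian. -/
def gaussianLaw (E : Type*) [NormedAddCommGroup E] [InnerProductSpace ℝ E] [FiniteDimensional ℝ E]
    [MeasurableSpace E] (v : ℝ) : Measure E :=
  (stdGaussian E).map fun z => Real.sqrt v • z

instance isProbabilityMeasure_gaussianLaw (v : ℝ) : IsProbabilityMeasure (gaussianLaw E v) :=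
  Measure.isProbabilityMeasure_map (by fun_prop)

lemma charFun_gaussianLaw {v : ℝ} (hv : 0 ≤ v) (t : E) :
    charFun (gaussianLaw E v) t = Complex.exp ((-(v * ‖t‖ ^ 2 / 2) : ℝ)) := by
  rw [gaussianLaw, charFun_map_smul, charFun_stdGaussian, norm_smul, Real.norm_of_nonneg
    (Real.sqrt_nonneg v)]
  congr 1
  push_cast
  rw [mul_pow, ← Complex.ofReal_pow, Real.sq_sqrt hv]
  ring

lemma withDensity_gaussianDensity {v : ℝ} (hv : 0 < v) :
    volume.withDensity (fun x : E => ENNReal.ofReal (gaussianDensity v x)) = gaussianLaw E v := by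
  have hfin : IsFiniteMeasure
      (volume.withDensity (fun x : E => ENNReal.ofReal (gaussianDensity v x))) :=
    isFiniteMeasure_withDensity_ofReal (integrable_gaussianDensity hv).2
  have hm : Measurable fun x : E => gaussianDensity v x :=
    measurable_gaussianDensity.comp (measurable_const.prodMk measurable_id)
  apply Measure.ext_of_charFun
  ext t
  have h0 : 0 < 2 * Real.pi * v := by positivity
  rw [charFun_gaussianLaw hv.le, charFun_apply,
    integral_withDensity_eq_integral_toReal_smul hm.ennreal_ofReal (by simp)]
  have h1 : ∀ x : E, (ENNReal.ofReal (gaussianDensity v x)).toReal •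
      Complex.exp ((inner ℝ x t : ℝ) * Complex.I) =
      ((2 * Real.pi * v : ℝ) : ℂ) ^ (-((Module.finrank ℝ E : ℂ) / 2)) *
        Complex.exp (-((1 / (2 * v) : ℝ) : ℂ) * ‖x‖ ^ 2 + Complex.I * (inner ℝ t x : ℝ)) := by
    intro x
    rw [ENNReal.toReal_ofReal (gaussianDensity_pos hv x).le, gaussianDensity, Complex.exp_add,
      Complex.real_smul, Complex.ofReal_mul, Complex.ofReal_cpow h0.le, Complex.ofReal_exp,
      mul_assoc, real_inner_comm]
    push_cast
    congr 3
    · field_simp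
    · rw [mul_comm]
  simp_rw [h1]
  rw [integral_const_mul, GaussianFourier.integral_cexp_neg_mul_sq_norm_add
    (by rw [Complex.ofReal_re]; positivity), ← mul_assoc]
  have h2 : (Real.pi : ℂ) / ((1 / (2 * v) : ℝ) : ℂ) = ((2 * Real.pi * v : ℝ) : ℂ) := by
    have : (v : ℂ) ≠ 0 := by exact_mod_cast hv.ne'
    push_cast
    field_simp
  rw [h2, Complex.cpow_neg, inv_mul_cancel₀, one_mul]
  · congr 1
    have : (v : ℂ) ≠ 0 := by exact_mod_cast hv.ne'
    push_cast
    rw [Complex.I_sq]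
    field_simp
    ring
  · rw [Ne, Complex.cpow_eq_zero_iff]
    have : ((2 * Real.pi * v : ℝ) : ℂ) ≠ 0 := by exact_mod_cast h0.ne'
    tauto

lemma integrable_sq_norm_stdGaussian : Integrable (fun x : E => ‖x‖ ^ 2) (stdGaussian E) := by
  have h : MemLp (id : E → E) 2 (stdGaussian E) := IsGaussian.memLp_two_id
  simpa using h.integrable_norm_pow (by norm_num)

lemma integral_sq_norm_stdGaussian :
    ∫ x : E, ‖x‖ ^ 2 ∂(stdGaussian E) = Module.finrank ℝ E := by
  have h : MemLp (id : E → E) 2 (stdGaussian E) := IsGaussian.memLp_two_id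
  have hi : ∀ i, Integrable (fun x : E => (inner ℝ (stdOrthonormalBasis ℝ E i) x) ^ 2)
      (stdGaussian E) := fun i => by
    have : MemLp (fun x : E => inner ℝ (stdOrthonormalBasis ℝ E i) x) 2 (stdGaussian E) :=
      (innerSL ℝ (stdOrthonormalBasis ℝ E i)).comp_memLp' h
    exact this.integrable_sq
  simp_rw [← (stdOrthonormalBasis ℝ E).sum_sq_inner_right]
  rw [integral_finsetSum _ fun i _ => hi i]
  have : ∀ i, ∫ x : E, (inner ℝ (stdOrthonormalBasis ℝ E i) x) ^ 2 ∂(stdGaussian E) = 1 := by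
    intro i
    have h1 := variance_dual_stdGaussian (innerSL ℝ (stdOrthonormalBasis ℝ E i))
    rw [variance_of_integral_eq_zero] at h1
    · simpa using h1
    · fun_prop
    · exact integral_strongDual_stdGaussian _
  simp [this]

end Gaussian

/-! ### Kullback-Leibler divergence and mutual information -/

section Divergence

variable {α β : Type*} [MeasurableSpace α] [MeasurableSpace β]

/-- The divergence between two probability laws with densities with respect to a common reference
measure is the mean log-ratio of the densities. -/
lemma klDiv_withDensity {m : Measure α} [SigmaFinite m] {f g : α → ℝ} (hf : Measurable f)
    (hg : Measurable g) (hf0 : ∀ᵐ a ∂m, 0 < f a) (hg0 : ∀ᵐ a ∂m, 0 < g a)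
    {ρ τ : Measure α} [IsProbabilityMeasure ρ] [IsProbabilityMeasure τ]
    (hρ : ρ = m.withDensity fun a => ENNReal.ofReal (f a))
    (hτ : τ = m.withDensity fun a => ENNReal.ofReal (g a))
    (hint : Integrable (fun a => Real.log (f a) - Real.log (g a)) ρ) :
    klDiv ρ τ ≠ ∞ ∧ (klDiv ρ τ).toReal = ∫ a, (Real.log (f a) - Real.log (g a)) ∂ρ := by
  have hρτ : ρ = τ.withDensity fun a => ENNReal.ofReal (f a / g a) := by
    have hfg : Measurable fun a => ENNReal.ofReal (f a / g a) := (hf.div hg).ennreal_ofReal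
    rw [hρ, hτ, ← withDensity_mul _ hg.ennreal_ofReal hfg]
    refine withDensity_congr_ae ?_
    filter_upwards [hf0, hg0] with a h1 h2
    rw [Pi.mul_apply, ← ENNReal.ofReal_mul h2.le]
    congr 1
    field_simp
  have hac : ρ ≪ τ := hρτ ▸ withDensity_absolutelyContinuous _ _
  have hm : ρ ≪ m := hρ ▸ withDensity_absolutelyContinuous _ _
  have hrn : ρ.rnDeriv τ =ᵐ[τ] fun a => ENNReal.ofReal (f a / g a) := by
    conv_lhs => rw [hρτ]
    exact Measure.rnDeriv_withDensity _ (hf.div hg).ennreal_ofReal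
  have hllr : llr ρ τ =ᵐ[ρ] fun a => Real.log (f a) - Real.log (g a) := by
    filter_upwards [hac.ae_le hrn, hm.ae_le hf0, hm.ae_le hg0] with a h1 h2 h3
    rw [llr, h1, ENNReal.toReal_ofReal (by positivity), Real.log_div h2.ne' h3.ne']
  refine ⟨klDiv_ne_top hac ((integrable_congr hllr).2 hint), ?_⟩
  rw [toReal_klDiv_of_measure_eq hac (by simp), integral_congr_ae hllr]

lemma klDiv_map_measurableEquiv (e : α ≃ᵐ β) (μ ν : Measure α) [IsFiniteMeasure μ]
    [IsFiniteMeasure ν] : klDiv (μ.map e) (ν.map e) = klDiv μ ν := by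
  refine le_antisymm (klDiv_map_le μ ν e.measurable) ?_
  have h := klDiv_map_le (μ.map e) (ν.map e) e.symm.measurable
  rwa [e.map_symm_map, e.map_symm_map] at h

/-- The golden formula: replacing the second marginal of the reference law by `Q` increases the
divergence by the divergence of the second marginal from `Q`. -/
lemma klDiv_fst_prod_eq_mutualInfo_add [StandardBorelSpace α] [Nonempty α]
    (ρ : Measure (α × β)) [IsProbabilityMeasure ρ] (Q : Measure β) [IsProbabilityMeasure Q] :
    klDiv ρ (ρ.fst.prod Q) = mutualInfo ρ + klDiv ρ.snd Q := by
  have key : ∀ S : Measure β, [IsProbabilityMeasure S] →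
      klDiv ρ (ρ.fst.prod S) =
        klDiv (ρ.snd ⊗ₘ (ρ.map Prod.swap).condKernel) (S ⊗ₘ Kernel.const β ρ.fst) := by
    intro S _
    rw [← klDiv_map_measurableEquiv MeasurableEquiv.prodComm, Measure.compProd_const]
    congr 1
    · have h := Measure.disintegrate (ρ.map Prod.swap) (ρ.map Prod.swap).condKernel
      rw [Measure.fst_map_swap] at h
      exact h.symm
    · exact Measure.prod_swap
  rw [mutualInfo, key Q, key ρ.snd, klDiv_compProd_eq_add, add_comm]

end Divergence

/-! ### The Bessel integral -/

section Bessel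

lemma integrableOn_rpow_mul_exp_neg_add_inv (s : ℝ) {A B : ℝ} (hA : 0 < A) (hB : 0 < B) :
    IntegrableOn (fun t : ℝ => t ^ s * Real.exp (-(A * t + B / t))) (Set.Ioi 0) := by
  obtain ⟨n, hn⟩ := exists_nat_gt (-1 - s)
  have h1 := (integrableOn_rpow_mul_exp_neg_mul_rpow (p := 1) (s := s + n) (b := A)
    (by linarith) one_pos hA).const_mul (n.factorial / B ^ n)
  refine Integrable.mono' h1 (by fun_prop) ?_
  filter_upwards [ae_restrict_mem measurableSet_Ioi] with t ht
  have ht : 0 < t := ht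
  rw [Real.norm_of_nonneg (by positivity), Real.rpow_one, Real.rpow_add ht, Real.rpow_natCast]
  -- `exp (B / t)` dominates every power of `B / t`, which tames any power of `t` at the origin
  have h2 : Real.exp (-(B / t)) ≤ n.factorial / B ^ n * t ^ n := by
    have h3 := Real.pow_div_factorial_le_exp (B / t) (by positivity) n
    rw [Real.exp_neg, inv_le_comm₀ (by positivity) (by positivity)]
    refine le_trans (le_of_eq ?_) h3
    rw [div_pow]
    field_simp
  calc t ^ s * Real.exp (-(A * t + B / t))
      = t ^ s * Real.exp (-A * t) * Real.exp (-(B / t)) := by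
        rw [mul_assoc, ← Real.exp_add]; congr 2; ring
    _ ≤ t ^ s * Real.exp (-A * t) * (n.factorial / B ^ n * t ^ n) := by gcongr
    _ = _ := by ring

lemma image_mul_exp {r : ℝ} (hr : 0 < r) :
    (fun s : ℝ => r * Real.exp s) '' Set.univ = Set.Ioi 0 := by
  ext t
  simp only [Set.image_univ, Set.mem_range, Set.mem_Ioi]
  constructor
  · rintro ⟨s, rfl⟩; positivity
  · intro ht
    exact ⟨Real.log (t / r), by rw [Real.exp_log (by positivity)]; field_simp⟩

/-- The integrand of the Bessel integral in the variable `t`, after the substitution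
`t = r exp s`. -/
lemma abs_mul_bessel_integrand (ν z : ℝ) {r : ℝ} (hr : 0 < r) (s : ℝ) :
    |r * Real.exp s| • ((r * Real.exp s) ^ (-ν - 1) *
        Real.exp (-(z / (2 * r) * (r * Real.exp s) + z * r / 2 / (r * Real.exp s)))) =
      r ^ (-ν) * (Real.exp (-(ν * s)) * Real.exp (-(z * Real.cosh s))) := by
  have h0 : 0 < r * Real.exp s := by positivity
  have h1 : z / (2 * r) * (r * Real.exp s) + z * r / 2 / (r * Real.exp s) = z * Real.cosh s := by
    rw [Real.cosh_eq, Real.exp_neg]; field_simp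
  rw [h1, abs_of_pos h0, smul_eq_mul, Real.rpow_sub_one h0.ne',
    Real.mul_rpow hr.le (Real.exp_pos s).le, ← Real.exp_mul, show s * -ν = -(ν * s) by ring]
  field_simp

lemma integrable_exp_mul_exp_neg_cosh (ν : ℝ) {z : ℝ} (hz : 0 < z) :
    Integrable fun s : ℝ => Real.exp (-(ν * s)) * Real.exp (-(z * Real.cosh s)) := by
  have h := (integrableOn_image_iff_integrableOn_abs_deriv_smul (s := Set.univ)
    (f := fun s : ℝ => 1 * Real.exp s) (f' := fun s => 1 * Real.exp s) MeasurableSet.univ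
    (fun s _ => ((Real.hasDerivAt_exp s).const_mul 1).hasDerivWithinAt)
    (fun x _ y _ hxy => by simpa using hxy)
    (fun t : ℝ => t ^ (-ν - 1) * Real.exp (-(z / (2 * 1) * t + z * 1 / 2 / t)))).1
    (by rw [image_mul_exp one_pos]
        exact integrableOn_rpow_mul_exp_neg_add_inv _ (by positivity) (by positivity))
  simp_rw [abs_mul_bessel_integrand ν z one_pos] at h
  simpa using h

lemma integral_exp_mul_exp_neg_cosh (ν : ℝ) {z : ℝ} (hz : 0 < z) :
    ∫ s : ℝ, Real.exp (-(ν * s)) * Real.exp (-(z * Real.cosh s)) = 2 * besselK ν z := by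
  set g : ℝ → ℝ := fun s => Real.exp (-(ν * s)) * Real.exp (-(z * Real.cosh s)) with hg
  have hi : Integrable g := integrable_exp_mul_exp_neg_cosh ν hz
  have hi' : Integrable fun s => g (-s) := hi.comp_neg
  have h1 : ∫ s, (g s + g (-s)) = (∫ s, g s) + ∫ s, g s := by
    rw [integral_add hi hi', integral_neg_eq_self]
  have h2 : ∫ s, (g s + g (-s)) =
      2 * ∫ s : ℝ, Real.exp (-(z * Real.cosh |s|)) * Real.cosh (ν * |s|) := by
    rw [← integral_const_mul]
    congr 1 with s
    rw [Real.cosh_abs, show Real.cosh (ν * |s|) = Real.cosh (ν * s) by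
      rcases abs_choice s with h | h <;> simp [h]]
    simp only [hg, Real.cosh_neg, Real.cosh_eq (ν * s), mul_neg, neg_neg]
    ring
  rw [integral_comp_abs (f := fun s => Real.exp (-(z * Real.cosh s)) * Real.cosh (ν * s))] at h2
  rw [besselK]
  linarith

/-- The Bessel function as the normalizing integral of the generalized inverse Gaussian law. -/
lemma integral_rpow_mul_exp_eq_besselK (ν : ℝ) {z r : ℝ} (hz : 0 < z) (hr : 0 < r) :
    ∫ t in Set.Ioi (0 : ℝ), t ^ (-ν - 1) * Real.exp (-(z / (2 * r) * t + z * r / 2 / t)) =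
      2 * r ^ (-ν) * besselK ν z := by
  rw [← image_mul_exp hr, integral_image_eq_integral_abs_deriv_smul (s := Set.univ)
    (f := fun s : ℝ => r * Real.exp s) (f' := fun s => r * Real.exp s) MeasurableSet.univ
    (fun s _ => ((Real.hasDerivAt_exp s).const_mul r).hasDerivWithinAt)
    (fun x _ y _ hxy => by simpa [hr.ne'] using hxy)]
  simp_rw [abs_mul_bessel_integrand ν z hr]
  rw [setIntegral_univ, integral_const_mul, integral_exp_mul_exp_neg_cosh ν hz]
  ring

lemma besselK_neg (ν z : ℝ) : besselK (-ν) z = besselK ν z := by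
  simp [besselK]

/-- The substitution `y = sinh (t / 2)` turns the integral into a Gaussian one. For `z ≤ 0` both sides
are the junk value `0`. -/
lemma besselK_half (z : ℝ) :
    besselK (1 / 2) z = Real.sqrt (Real.pi / (2 * z)) * Real.exp (-z) := by
  have him : (fun t : ℝ => Real.sinh (t / 2)) '' Set.Ioi 0 = Set.Ioi 0 := by
    ext y
    constructor
    · rintro ⟨t, ht, rfl⟩
      exact Real.sinh_pos_iff.2 (half_pos ht)
    · intro hy
      refine ⟨2 * Real.arsinh y, ?_, ?_⟩
      · simpa using hy
      · simp
  have h := integral_image_eq_integral_abs_deriv_smul (s := Set.Ioi 0)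
    (f := fun t : ℝ => Real.sinh (t / 2)) (f' := fun t => Real.cosh (t / 2) * (1 / 2))
    measurableSet_Ioi
    (fun t _ => (((hasDerivAt_id t).div_const 2).sinh).hasDerivWithinAt)
    (fun x _ y _ hxy => by simpa using hxy) (fun y => Real.exp (-(2 * z) * y ^ 2))
  rw [him, integral_gaussian_Ioi] at h
  have h1 : ∀ t : ℝ, Real.exp (-(z * Real.cosh t)) * Real.cosh (1 / 2 * t) =
      2 * Real.exp (-z) * (|Real.cosh (t / 2) * (1 / 2)| •
        Real.exp (-(2 * z) * Real.sinh (t / 2) ^ 2)) := by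
    intro t
    have h2 : Real.cosh t = 1 + 2 * Real.sinh (t / 2) ^ 2 := by
      have := Real.cosh_two_mul (t / 2)
      rw [Real.cosh_sq, show 2 * (t / 2) = t by ring] at this
      linarith
    rw [h2, abs_of_pos (mul_pos (Real.cosh_pos _) (by norm_num)), smul_eq_mul,
      show 1 / 2 * t = t / 2 by ring,
      show -(z * (1 + 2 * Real.sinh (t / 2) ^ 2)) = -z + -(2 * z) * Real.sinh (t / 2) ^ 2 by ring,
      Real.exp_add]
    ring
  rw [besselK]
  simp_rw [h1]
  rw [integral_const_mul, ← h]
  ring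

lemma integrableOn_besselK_integrand (ν : ℝ) {z : ℝ} (hz : 0 < z) :
    IntegrableOn (fun t : ℝ => Real.exp (-(z * Real.cosh t)) * Real.cosh (ν * t))
      (Set.Ioi 0) := by
  have h1 := integrable_exp_mul_exp_neg_cosh ν hz
  have h2 := ((h1.add h1.comp_neg).div_const 2).integrableOn (s := Set.Ioi 0)
  refine h2.congr_fun (fun t _ => ?_) measurableSet_Ioi
  simp only [Pi.add_apply, Real.cosh_neg, Real.cosh_eq (ν * t), mul_neg, neg_neg]
  ring

lemma exp_neg_mul_cosh_one_le_besselK (ν : ℝ) {z : ℝ} (hz : 0 < z) :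
    Real.exp (-(z * Real.cosh 1)) ≤ besselK ν z := by
  have hi := integrableOn_besselK_integrand ν hz
  have hsub : Set.Ioc (0 : ℝ) 1 ⊆ Set.Ioi 0 := fun t ht => ht.1
  calc Real.exp (-(z * Real.cosh 1))
      = ∫ t in Set.Ioc (0 : ℝ) 1, Real.exp (-(z * Real.cosh 1)) := by simp
    _ ≤ ∫ t in Set.Ioc (0 : ℝ) 1, Real.exp (-(z * Real.cosh t)) * Real.cosh (ν * t) := by
        refine setIntegral_mono_on (integrableOn_const (by simp)) (hi.mono_set hsub)
          measurableSet_Ioc fun t ht => ?_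
        have h1 : Real.cosh t ≤ Real.cosh 1 :=
          Real.cosh_le_cosh.2 (by rw [abs_of_pos ht.1, abs_one]; exact ht.2)
        have h2 : Real.exp (-(z * Real.cosh 1)) ≤ Real.exp (-(z * Real.cosh t)) := by gcongr
        exact h2.trans (le_mul_of_one_le_right (Real.exp_pos _).le (Real.one_le_cosh _))
    _ ≤ besselK ν z := by
        refine setIntegral_mono_set hi (ae_of_all _ fun t => ?_) (ae_of_all _ hsub)
        exact mul_nonneg (Real.exp_pos _).le (Real.cosh_pos _).le

lemma besselK_pos (ν : ℝ) {z : ℝ} (hz : 0 < z) : 0 < besselK ν z :=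
  (Real.exp_pos _).trans_le (exp_neg_mul_cosh_one_le_besselK ν hz)

lemma besselK_le_besselK (ν : ℝ) {z w : ℝ} (hz : 0 < z) (hzw : z ≤ w) :
    besselK ν w ≤ besselK ν z := by
  refine setIntegral_mono (integrableOn_besselK_integrand ν (hz.trans_le hzw))
    (integrableOn_besselK_integrand ν hz) fun t => ?_
  have := Real.cosh_pos (ν * t)
  have := Real.cosh_pos t
  dsimp only
  gcongr

lemma measurable_besselK (ν : ℝ) : Measurable (besselK ν) := by
  have h : StronglyMeasurable (Function.uncurry fun z t : ℝ =>
      Real.exp (-(z * Real.cosh t)) * Real.cosh (ν * t)) := by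
    refine Measurable.stronglyMeasurable ?_
    unfold Function.uncurry
    fun_prop
  exact (h.integral_prod_right (ν := volume.restrict (Set.Ioi 0))).measurable

end Bessel

/-! ### The inverse Gaussian law -/

section InverseGaussian

/-- The density of the inverse Gaussian law `IG(m, κ)` on the positive half-line. -/
def inverseGaussianDensity (m κ t : ℝ) : ℝ :=
  Real.sqrt (κ / (2 * Real.pi * t ^ 3)) * Real.exp (-(κ * (t - m) ^ 2 / (2 * m ^ 2 * t)))

lemma measurable_inverseGaussianDensity (m κ : ℝ) : Measurable (inverseGaussianDensity m κ) := by
  unfold inverseGaussianDensity; fun_prop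

lemma inverseGaussianDensity_nonneg (m κ t : ℝ) : 0 ≤ inverseGaussianDensity m κ t := by
  unfold inverseGaussianDensity; positivity

lemma inverseGaussianDensity_eq {m κ t : ℝ} (hm : 0 < m) (hκ : 0 < κ) (ht : 0 < t) :
    inverseGaussianDensity m κ t = Real.sqrt (κ / (2 * Real.pi)) * Real.exp (κ / m) *
      (t ^ (-(1 / 2 : ℝ) - 1) *
        Real.exp (-(κ / m / (2 * m) * t + κ / m * m / 2 / t))) := by
  have h1 : Real.sqrt (κ / (2 * Real.pi * t ^ 3)) =
      Real.sqrt (κ / (2 * Real.pi)) * t ^ (-(1 / 2 : ℝ) - 1) := by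
    rw [← div_div, Real.sqrt_div' _ (by positivity), Real.sqrt_eq_rpow (t ^ 3), ← Real.rpow_natCast,
      ← Real.rpow_mul ht.le, div_eq_mul_inv, ← Real.rpow_neg ht.le]
    norm_num
  have h2 : Real.exp (-(κ * (t - m) ^ 2 / (2 * m ^ 2 * t))) =
      Real.exp (κ / m) * Real.exp (-(κ / m / (2 * m) * t + κ / m * m / 2 / t)) := by
    rw [← Real.exp_add]
    congr 1
    field_simp
    ring
  rw [inverseGaussianDensity, h1, h2]
  ring

lemma inverseGaussian_eq (m κ : ℝ) : inverseGaussian m κ =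
    (volume.restrict (Set.Ioi 0)).withDensity
      fun t => ENNReal.ofReal (inverseGaussianDensity m κ t) := rfl

lemma ae_inverseGaussian_pos (m κ : ℝ) : ∀ᵐ t ∂(inverseGaussian m κ), 0 < t :=
  (withDensity_absolutelyContinuous _ _).ae_le (ae_restrict_mem measurableSet_Ioi)

lemma integrable_inverseGaussian_iff (m κ : ℝ) (g : ℝ → ℝ) :
    Integrable g (inverseGaussian m κ) ↔
      IntegrableOn (fun t => inverseGaussianDensity m κ t * g t) (Set.Ioi 0) := by
  rw [inverseGaussian_eq, integrable_withDensity_iff_integrable_smul'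
    (measurable_inverseGaussianDensity m κ).ennreal_ofReal (by simp), IntegrableOn]
  simp_rw [ENNReal.toReal_ofReal (inverseGaussianDensity_nonneg m κ _), smul_eq_mul]

lemma integral_inverseGaussian (m κ : ℝ) (g : ℝ → ℝ) :
    ∫ t, g t ∂(inverseGaussian m κ) =
      ∫ t in Set.Ioi 0, inverseGaussianDensity m κ t * g t := by
  rw [inverseGaussian_eq, integral_withDensity_eq_integral_toReal_smul
    (measurable_inverseGaussianDensity m κ).ennreal_ofReal (by simp)]
  simp_rw [ENNReal.toReal_ofReal (inverseGaussianDensity_nonneg m κ _), smul_eq_mul]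

lemma inverseGaussianDensity_mul_rpow {m κ t : ℝ} (hm : 0 < m) (hκ : 0 < κ) (k : ℝ) (ht : 0 < t) :
    inverseGaussianDensity m κ t * t ^ k = Real.sqrt (κ / (2 * Real.pi)) * Real.exp (κ / m) *
      (t ^ (-(1 / 2 - k) - 1) *
        Real.exp (-(κ / m / (2 * m) * t + κ / m * m / 2 / t))) := by
  rw [inverseGaussianDensity_eq hm hκ ht,
    show -(1 / 2 - k) - 1 = (-(1 / 2 : ℝ) - 1) + k by ring, Real.rpow_add ht]
  ring

lemma integrable_rpow_inverseGaussian {m κ : ℝ} (hm : 0 < m) (hκ : 0 < κ) (k : ℝ) :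
    Integrable (fun t => t ^ k) (inverseGaussian m κ) := by
  rw [integrable_inverseGaussian_iff]
  refine IntegrableOn.congr_fun ?_
    (fun t ht => (inverseGaussianDensity_mul_rpow hm hκ k ht).symm) measurableSet_Ioi
  exact (integrableOn_rpow_mul_exp_neg_add_inv _ (by positivity) (by positivity)).const_mul _

lemma integral_rpow_inverseGaussian {m κ : ℝ} (hm : 0 < m) (hκ : 0 < κ) (k : ℝ) :
    ∫ t, t ^ k ∂(inverseGaussian m κ) = Real.sqrt (κ / (2 * Real.pi)) * Real.exp (κ / m) *
      (2 * m ^ (-(1 / 2 - k)) * besselK (1 / 2 - k) (κ / m)) := by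
  rw [integral_inverseGaussian, setIntegral_congr_fun measurableSet_Ioi
    (fun t ht => inverseGaussianDensity_mul_rpow hm hκ k ht), integral_const_mul,
    integral_rpow_mul_exp_eq_besselK _ (by positivity) hm]

/-- The moments of order `0` and `1` reduce to `K_{1/2}`, which is elementary. -/
lemma inverseGaussian_normalization {m κ : ℝ} (hm : 0 < m) (hκ : 0 < κ) :
    Real.sqrt (κ / (2 * Real.pi)) * Real.exp (κ / m) *
      (2 * m ^ (-(1 / 2 : ℝ)) * besselK (1 / 2) (κ / m)) = 1 := by
  have h1 : Real.sqrt (Real.pi / (2 * (κ / m))) =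
      (Real.sqrt (κ / (2 * Real.pi)))⁻¹ * Real.sqrt m / 2 := by
    rw [← Real.sqrt_inv, ← Real.sqrt_mul (by positivity), Real.sqrt_eq_iff_mul_self_eq
      (by positivity) (by positivity), div_mul_div_comm, Real.mul_self_sqrt (by positivity)]
    field_simp
  have h2 : 0 < Real.sqrt (κ / (2 * Real.pi)) := by positivity
  have h3 : 0 < Real.sqrt m := by positivity
  rw [besselK_half, h1, Real.rpow_neg hm.le, ← Real.sqrt_eq_rpow, Real.exp_neg]
  field_simp

lemma isProbabilityMeasure_inverseGaussian {m κ : ℝ} (hm : 0 < m) (hκ : 0 < κ) :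
    IsProbabilityMeasure (inverseGaussian m κ) := by
  have h := integral_rpow_inverseGaussian hm hκ 0
  rw [sub_zero, inverseGaussian_normalization hm hκ] at h
  simp only [Real.rpow_zero, integral_const, smul_eq_mul, mul_one] at h
  exact ⟨(ENNReal.toReal_eq_one_iff _).1 h⟩

lemma integrable_id_inverseGaussian {m κ : ℝ} (hm : 0 < m) (hκ : 0 < κ) :
    Integrable (fun t => t) (inverseGaussian m κ) := by
  simpa using integrable_rpow_inverseGaussian hm hκ 1

lemma integral_id_inverseGaussian {m κ : ℝ} (hm : 0 < m) (hκ : 0 < κ) :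
    ∫ t, t ∂(inverseGaussian m κ) = m := by
  have h := integral_rpow_inverseGaussian hm hκ 1
  have h1 := inverseGaussian_normalization hm hκ
  have h2 : m ^ (-(1 / 2 - 1) : ℝ) = m ^ (-(1 / 2 : ℝ)) * m := by
    rw [← Real.rpow_add_one hm.ne']; norm_num
  rw [show (1 / 2 - 1 : ℝ) = -(1 / 2) by norm_num, besselK_neg,
    show -(-(1 / 2) : ℝ) = -(1 / 2 - 1) by norm_num, h2] at h
  simp only [Real.rpow_one] at h
  rw [h]
  linear_combination m * h1

lemma integrable_inv_inverseGaussian {m κ : ℝ} (hm : 0 < m) (hκ : 0 < κ) :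
    Integrable (fun t => t⁻¹) (inverseGaussian m κ) := by
  simpa [Real.rpow_neg_one] using integrable_rpow_inverseGaussian hm hκ (-1)

lemma integrable_log_inverseGaussian {m κ : ℝ} (hm : 0 < m) (hκ : 0 < κ) :
    Integrable Real.log (inverseGaussian m κ) := by
  refine Integrable.mono' ((integrable_id_inverseGaussian hm hκ).add
    (integrable_inv_inverseGaussian hm hκ)) (by fun_prop) ?_
  filter_upwards [ae_inverseGaussian_pos m κ] with t ht
  have h1 := Real.log_le_sub_one_of_pos ht
  have h2 := Real.one_sub_inv_le_log_of_pos ht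
  have h3 : 0 < t⁻¹ := by positivity
  rw [Pi.add_apply, Real.norm_eq_abs, abs_le]
  constructor <;> linarith

end InverseGaussian

/-! ### The noise density as a Gaussian mixture -/

section Density

variable {d : ℕ} {lam u : ℝ}

lemma finrank_plane (hd : 2 ≤ d) : (Module.finrank ℝ (Plane d) : ℝ) = (d : ℝ) - 1 := by
  rw [finrank_euclideanSpace_fin, Nat.cast_sub (by omega), Nat.cast_one]

lemma dimension_pos (hd : 2 ≤ d) : (0 : ℝ) < (d : ℝ) - 1 := by
  have : (2 : ℝ) ≤ d := by exact_mod_cast hd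
  linarith

/-- Mixing the Gaussian densities of variance `σ² t` over the hitting time produces the noise
density: the exponents combine into the Bessel integral with argument `u ρ` and scale
`ρ / (u σ²)`, where `ρ = √(‖n‖² + lam²)`. -/
lemma lintegral_gaussianDensity_hittingTime (hd : 2 ≤ d) (hlam : 0 < lam) (hu : 0 < u) {σ : ℝ}
    (hσ : 0 < σ) (n : Plane d) :
    ∫⁻ t, ENNReal.ofReal (gaussianDensity (σ ^ 2 * t) n) ∂(hittingTime lam u σ) =
      ENNReal.ofReal (pdf d lam u n) := by
  set m : ℝ := lam / (u * σ ^ 2) with hm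
  set κ : ℝ := lam ^ 2 / σ ^ 2 with hκ
  have hm0 : 0 < m := by positivity
  have hκ0 : 0 < κ := by positivity
  set ρ : ℝ := Real.sqrt (‖n‖ ^ 2 + lam ^ 2) with hρ
  have hρ0 : 0 < ρ := by positivity
  have hρ2 : ρ ^ 2 = ‖n‖ ^ 2 + lam ^ 2 := Real.sq_sqrt (by positivity)
  set r : ℝ := ρ / (u * σ ^ 2) with hr
  have hr0 : 0 < r := by positivity
  set C : ℝ := Real.sqrt (κ / (2 * Real.pi)) * Real.exp (lam * u) *
    (2 * Real.pi * σ ^ 2) ^ (-(((d : ℝ) - 1) / 2)) with hC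
  have hpt : ∀ t ∈ Set.Ioi (0 : ℝ),
      inverseGaussianDensity m κ t * gaussianDensity (σ ^ 2 * t) n =
      C * (t ^ (-((d : ℝ) / 2) - 1) *
        Real.exp (-(u * ρ / (2 * r) * t + u * ρ * r / 2 / t))) := by
    intro t ht
    have ht : 0 < t := ht
    rw [inverseGaussianDensity_eq hm0 hκ0 ht, gaussianDensity, finrank_plane hd,
      ← mul_assoc (2 * Real.pi), Real.mul_rpow (by positivity) ht.le,
      show -((d : ℝ) / 2) - 1 = (-(1 / 2 : ℝ) - 1) + -(((d : ℝ) - 1) / 2) by ring,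
      Real.rpow_add ht]
    have hexp : Real.exp (κ / m) * Real.exp (-(κ / m / (2 * m) * t + κ / m * m / 2 / t)) *
        Real.exp (-(‖n‖ ^ 2 / (2 * (σ ^ 2 * t)))) = Real.exp (lam * u) *
        Real.exp (-(u * ρ / (2 * r) * t + u * ρ * r / 2 / t)) := by
      rw [← Real.exp_add, ← Real.exp_add, ← Real.exp_add]
      congr 1
      have e1 : u * ρ * r / 2 / t = (‖n‖ ^ 2 + lam ^ 2) / (2 * (σ ^ 2 * t)) := by
        rw [← hρ2, hr]; field_simp
      have e2 : u * ρ / (2 * r) * t = u ^ 2 * σ ^ 2 / 2 * t := by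
        rw [hr]; field_simp
      rw [e1, e2, hκ, hm]
      field_simp
      ring
    rw [hC]
    linear_combination Real.sqrt (κ / (2 * Real.pi)) *
      (2 * Real.pi * σ ^ 2) ^ (-(((d : ℝ) - 1) / 2)) * t ^ (-(1 / 2 : ℝ) - 1) *
      t ^ (-(((d : ℝ) - 1) / 2)) * hexp
  have hconst : C * (2 * r ^ (-((d : ℝ) / 2)) * besselK ((d : ℝ) / 2) (u * ρ)) =
      pdf d lam u n := by
    have h2p : (0 : ℝ) < 2 * Real.pi := by positivity
    have e1 : Real.sqrt (κ / (2 * Real.pi)) = lam / σ * (2 * Real.pi) ^ (-(1 / 2 : ℝ)) := by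
      rw [hκ, Real.sqrt_div' _ h2p.le, ← div_pow, Real.sqrt_sq (by positivity),
        Real.sqrt_eq_rpow, Real.rpow_neg h2p.le, div_eq_mul_inv]
    have e2 : (2 * Real.pi * σ ^ 2) ^ (-(((d : ℝ) - 1) / 2)) =
        (2 * Real.pi) ^ (-(((d : ℝ) - 1) / 2)) * (σ ^ (-(d : ℝ)) * σ) := by
      rw [Real.mul_rpow h2p.le (by positivity), ← Real.rpow_natCast σ 2, ← Real.rpow_mul hσ.le,
        ← Real.rpow_add_one hσ.ne']
      congr 2
      push_cast
      ring
    have e3 : r ^ (-((d : ℝ) / 2)) = (u / ρ) ^ ((d : ℝ) / 2) * σ ^ (d : ℝ) := by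
      rw [Real.rpow_neg hr0.le, ← Real.inv_rpow hr0.le,
        show r⁻¹ = u / ρ * σ ^ 2 by rw [hr]; field_simp,
        Real.mul_rpow (by positivity) (by positivity), ← Real.rpow_natCast σ 2,
        ← Real.rpow_mul hσ.le]
      congr 2
      push_cast
      ring
    have e4 : (2 * Real.pi) ^ (-(1 / 2 : ℝ)) * (2 * Real.pi) ^ (-(((d : ℝ) - 1) / 2)) * 2 =
        1 / (2 ^ ((d : ℝ) / 2 - 1) * Real.pi ^ ((d : ℝ) / 2)) := by
      rw [← Real.rpow_add h2p, show -(1 / 2 : ℝ) + -(((d : ℝ) - 1) / 2) = -((d : ℝ) / 2) by ring,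
        Real.rpow_neg h2p.le, Real.mul_rpow (by norm_num) Real.pi_pos.le,
        Real.rpow_sub_one (by norm_num)]
      field_simp
    have e5 : σ ^ (-(d : ℝ)) * σ ^ (d : ℝ) = 1 := by
      rw [← Real.rpow_add hσ]; simp
    rw [pdf, ← hρ, hC, e1, e2, e3]
    calc _ = lam * ((2 * Real.pi) ^ (-(1 / 2 : ℝ)) * (2 * Real.pi) ^ (-(((d : ℝ) - 1) / 2)) * 2) *
          (σ ^ (-(d : ℝ)) * σ ^ (d : ℝ)) * (σ / σ) * (u / ρ) ^ ((d : ℝ) / 2) *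
          Real.exp (lam * u) * besselK ((d : ℝ) / 2) (u * ρ) := by ring
      _ = _ := by rw [e4, e5, div_self hσ.ne']; ring
  have hint := (integrableOn_rpow_mul_exp_neg_add_inv (-((d : ℝ) / 2) - 1)
    (A := u * ρ / (2 * r)) (B := u * ρ * r / 2) (by positivity) (by positivity)).const_mul C
  have hmg : Measurable fun t : ℝ => ENNReal.ofReal (gaussianDensity (σ ^ 2 * t) n) :=
    (measurable_gaussianDensity.comp
      ((measurable_const.mul measurable_id).prodMk measurable_const)).ennreal_ofReal
  rw [hittingTime, inverseGaussian_eq, lintegral_withDensity_eq_lintegral_mul _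
    (measurable_inverseGaussianDensity _ _).ennreal_ofReal hmg]
  rw [setLIntegral_congr_fun (g := fun t => ENNReal.ofReal (C * (t ^ (-((d : ℝ) / 2) - 1) *
        Real.exp (-(u * ρ / (2 * r) * t + u * ρ * r / 2 / t))))) measurableSet_Ioi
    (fun t ht => by
      rw [Pi.mul_apply, ← ENNReal.ofReal_mul (inverseGaussianDensity_nonneg _ _ _), hpt t ht])]
  rw [← ofReal_integral_eq_lintegral_ofReal hint, integral_const_mul,
    integral_rpow_mul_exp_eq_besselK _ (by positivity) hr0, hconst]
  filter_upwards [ae_restrict_mem measurableSet_Ioi] with t ht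
  have ht : 0 < t := ht
  show (0 : ℝ) ≤ _
  positivity

lemma pdf_pos (hlam : 0 < lam) (hu : 0 < u) (n : Plane d) : 0 < pdf d lam u n := by
  have h1 : 0 < Real.sqrt (‖n‖ ^ 2 + lam ^ 2) := by positivity
  have h2 := besselK_pos ((d : ℝ) / 2) (mul_pos hu h1)
  unfold pdf
  positivity

lemma measurable_pdf : Measurable (pdf d lam u) := by
  have h : Measurable fun n : Plane d =>
      besselK ((d : ℝ) / 2) (u * Real.sqrt (‖n‖ ^ 2 + lam ^ 2)) :=
    (measurable_besselK _).comp (by fun_prop)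
  unfold pdf
  fun_prop

/-- The logarithm of the noise density grows at most quadratically. -/
lemma exists_abs_log_pdf_le (hlam : 0 < lam) (hu : 0 < u) :
    ∃ A B : ℝ, ∀ n : Plane d, |Real.log (pdf d lam u n)| ≤ A + B * ‖n‖ ^ 2 := by
  set c : ℝ := lam / ((2 : ℝ) ^ ((d : ℝ) / 2 - 1) * Real.pi ^ ((d : ℝ) / 2)) with hc
  have hc0 : 0 < c := by positivity
  set K : ℝ := |Real.log (besselK ((d : ℝ) / 2) (u * lam))|
  refine ⟨|Real.log c| + d / 2 * (|Real.log u| + lam⁻¹ + (1 + lam ^ 2)) + lam * u +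
    (K + u * (1 + lam ^ 2) * Real.cosh 1), d / 2 + u * Real.cosh 1, fun n => ?_⟩
  set ρ : ℝ := Real.sqrt (‖n‖ ^ 2 + lam ^ 2) with hρ
  have hρ0 : 0 < ρ := by positivity
  have hρ2 : ρ ^ 2 = ‖n‖ ^ 2 + lam ^ 2 := Real.sq_sqrt (by positivity)
  have hρl : lam ≤ ρ := Real.le_sqrt_of_sq_le (by nlinarith [sq_nonneg ‖n‖])
  have hρu : ρ ≤ 1 + lam ^ 2 + ‖n‖ ^ 2 := by nlinarith [sq_nonneg (ρ - 1)]
  have hb := besselK_pos ((d : ℝ) / 2) (mul_pos hu hρ0)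
  have hlog : Real.log (pdf d lam u n) = Real.log c + d / 2 * (Real.log u - Real.log ρ) + lam * u +
      Real.log (besselK ((d : ℝ) / 2) (u * ρ)) := by
    rw [pdf, ← hρ, ← hc, Real.log_mul (by positivity) hb.ne', Real.log_mul (by positivity)
      (by positivity), Real.log_mul (by positivity) (by positivity), Real.log_rpow (by positivity),
      Real.log_div hu.ne' hρ0.ne', Real.log_exp]
  have h1 : |Real.log ρ| ≤ lam⁻¹ + (1 + lam ^ 2) + ‖n‖ ^ 2 := by
    have e1 := Real.log_le_sub_one_of_pos hρ0
    have e2 := Real.one_sub_inv_le_log_of_pos hρ0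
    have e3 : ρ⁻¹ ≤ lam⁻¹ := inv_anti₀ hlam hρl
    have e4 : 0 < lam⁻¹ := by positivity
    rw [abs_le]
    constructor <;> nlinarith [sq_nonneg lam, sq_nonneg ‖n‖]
  have h2 : |Real.log (besselK ((d : ℝ) / 2) (u * ρ))| ≤
      K + u * (1 + lam ^ 2) * Real.cosh 1 + u * Real.cosh 1 * ‖n‖ ^ 2 := by
    have e1 : Real.log (besselK ((d : ℝ) / 2) (u * ρ)) ≤ K :=
      (Real.log_le_log hb (besselK_le_besselK _ (by positivity) (by gcongr))).trans (le_abs_self _)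
    have e2 : -(u * ρ * Real.cosh 1) ≤ Real.log (besselK ((d : ℝ) / 2) (u * ρ)) := by
      rw [Real.le_log_iff_exp_le hb]
      exact exp_neg_mul_cosh_one_le_besselK _ (by positivity)
    have e3 : 0 < u * Real.cosh 1 := mul_pos hu (Real.cosh_pos 1)
    have e4 : 0 ≤ K := abs_nonneg _
    have e5 := mul_le_mul_of_nonneg_left hρu e3.le
    have e6 := mul_pos e3 hρ0
    rw [abs_le]
    constructor <;> nlinarith
  rw [hlog]
  have hd : (0 : ℝ) ≤ d / 2 := by positivity
  have h3 : |(d : ℝ) / 2 * (Real.log u - Real.log ρ)| ≤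
      d / 2 * (|Real.log u| + (lam⁻¹ + (1 + lam ^ 2) + ‖n‖ ^ 2)) := by
    rw [abs_mul, abs_of_nonneg hd]
    exact mul_le_mul_of_nonneg_left ((abs_sub _ _).trans (by gcongr)) hd
  have h4 : |lam * u| = lam * u := abs_of_pos (by positivity)
  calc _ ≤ |Real.log c| + |(d : ℝ) / 2 * (Real.log u - Real.log ρ)| + |lam * u| +
        |Real.log (besselK ((d : ℝ) / 2) (u * ρ))| :=
        (abs_add_le _ _).trans (add_le_add_left ((abs_add_le _ _).trans
          (add_le_add_left (abs_add_le _ _) _)) _)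
    _ ≤ _ := by rw [h4]; linarith

end Density

/-! ### Gaussian scale mixtures -/

section Mixture

variable {E : Type*} [NormedAddCommGroup E] [InnerProductSpace ℝ E] [FiniteDimensional ℝ E]
  [MeasurableSpace E] [BorelSpace E]

/-- The joint law of `(T, √(c T) • Z)`, where `T` has law `τ` and `Z`, independent of `T`, is
standard Gaussian. -/
def gaussianMixture (E : Type*) [NormedAddCommGroup E] [InnerProductSpace ℝ E]
    [FiniteDimensional ℝ E] [MeasurableSpace E] (τ : Measure ℝ) (c : ℝ → ℝ) : Measure (ℝ × E) :=
  (τ.prod (stdGaussian E)).map fun q => (q.1, Real.sqrt (c q.1) • q.2)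

variable {τ : Measure ℝ} {c : ℝ → ℝ}

omit [FiniteDimensional ℝ E] in
lemma measurable_mixtureMap (hc : Measurable c) :
    Measurable fun q : ℝ × E => (q.1, Real.sqrt (c q.1) • q.2) := by
  fun_prop

lemma isProbabilityMeasure_gaussianMixture [IsProbabilityMeasure τ] (hc : Measurable c) :
    IsProbabilityMeasure (gaussianMixture E τ c) :=
  Measure.isProbabilityMeasure_map (measurable_mixtureMap hc).aemeasurable

lemma fst_gaussianMixture [SFinite τ] (hc : Measurable c) :
    (gaussianMixture E τ c).fst = τ := by
  rw [gaussianMixture, Measure.fst, Measure.map_map measurable_fst (measurable_mixtureMap hc)]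
  change (τ.prod (stdGaussian E)).fst = τ
  exact Measure.fst_prod

lemma gaussianMixture_eq_withDensity [SFinite τ] (hc : Measurable c)
    (hc0 : ∀ᵐ t ∂τ, 0 < c t) :
    gaussianMixture E τ c = (τ.prod volume).withDensity
      fun q => ENNReal.ofReal (gaussianDensity (c q.1) q.2) := by
  have hm : Measurable fun q : ℝ × E => ENNReal.ofReal (gaussianDensity (c q.1) q.2) :=
    (measurable_gaussianDensity.comp
      ((hc.comp measurable_fst).prodMk measurable_snd)).ennreal_ofReal
  ext S hS
  rw [gaussianMixture, Measure.map_apply (measurable_mixtureMap hc) hS,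
    Measure.prod_apply (measurable_mixtureMap hc hS), withDensity_apply _ hS,
    ← lintegral_indicator hS, lintegral_prod _ (hm.indicator hS).aemeasurable]
  refine lintegral_congr_ae ?_
  filter_upwards [hc0] with t ht
  have hSt : MeasurableSet (Prod.mk t ⁻¹' S) := measurable_prodMk_left hS
  have h1 : gaussianLaw E (c t) (Prod.mk t ⁻¹' S) =
      stdGaussian E (Prod.mk t ⁻¹' ((fun q : ℝ × E => (q.1, Real.sqrt (c q.1) • q.2)) ⁻¹' S)) := by
    rw [gaussianLaw, Measure.map_apply (by fun_prop) hSt]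
    rfl
  rw [← h1, ← withDensity_gaussianDensity ht, withDensity_apply _ hSt, ← lintegral_indicator hSt]
  rfl

lemma snd_gaussianMixture (hc : Measurable c) :
    (gaussianMixture E τ c).snd =
      (τ.prod (stdGaussian E)).map fun q => Real.sqrt (c q.1) • q.2 := by
  rw [gaussianMixture, Measure.snd, Measure.map_map measurable_snd (measurable_mixtureMap hc)]
  rfl

variable [IsProbabilityMeasure τ]

lemma charFun_snd_gaussianMixture (hc : Measurable c) (hc0 : ∀ᵐ t ∂τ, 0 ≤ c t) (ξ : E) :
    charFun (gaussianMixture E τ c).snd ξ =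
      ∫ t, Complex.exp ((-(c t * ‖ξ‖ ^ 2 / 2) : ℝ)) ∂τ := by
  have hm : Measurable fun q : ℝ × E => Real.sqrt (c q.1) • q.2 := by fun_prop
  rw [snd_gaussianMixture hc, charFun_apply, integral_map hm.aemeasurable (by fun_prop),
    integral_prod]
  · refine integral_congr_ae ?_
    filter_upwards [hc0] with t ht
    rw [← charFun_gaussianLaw ht, charFun_apply, gaussianLaw, integral_map (by fun_prop)
      (by fun_prop)]
  · refine Integrable.of_bound (C := 1) (by fun_prop) (ae_of_all _ fun q => ?_)
    rw [Complex.norm_exp_ofReal_mul_I]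

/-- Adding an independent Gaussian vector of variance `v` shifts the mixed variance by `v`. -/
lemma gaussianLaw_conv_snd_gaussianMixture (hc : Measurable c) (hc0 : ∀ᵐ t ∂τ, 0 ≤ c t)
    {v : ℝ} (hv : 0 ≤ v) :
    (gaussianLaw E v).conv (gaussianMixture E τ c).snd =
      (gaussianMixture E τ fun t => v + c t).snd := by
  have hc' : Measurable fun t => v + c t := by fun_prop
  have := isProbabilityMeasure_gaussianMixture (E := E) (τ := τ) hc
  have := isProbabilityMeasure_gaussianMixture (E := E) (τ := τ) hc'
  apply Measure.ext_of_charFun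
  ext ξ
  rw [charFun_conv, charFun_gaussianLaw hv, charFun_snd_gaussianMixture hc hc0,
    charFun_snd_gaussianMixture hc' (hc0.mono fun t ht => add_nonneg hv ht), ← integral_const_mul]
  congr 1 with t
  rw [← Complex.exp_add]
  congr 1
  push_cast
  ring

omit [BorelSpace E] [IsProbabilityMeasure τ] in
lemma sq_norm_sqrt_smul (hc0 : ∀ᵐ t ∂τ, 0 < c t) :
    (fun q : ℝ × E => ‖Real.sqrt (c q.1) • q.2‖ ^ 2) =ᵐ[τ.prod (stdGaussian E)]
      fun q => c q.1 * ‖q.2‖ ^ 2 := by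
  filter_upwards [Measure.quasiMeasurePreserving_fst.ae hc0] with q hq
  rw [norm_smul, mul_pow, Real.norm_of_nonneg (Real.sqrt_nonneg _), Real.sq_sqrt hq.le]

omit [IsProbabilityMeasure τ] in
lemma integrable_sq_norm_snd_gaussianMixture [SFinite τ] (hc : Measurable c)
    (hc0 : ∀ᵐ t ∂τ, 0 < c t) (hci : Integrable c τ) :
    Integrable (fun y : E => ‖y‖ ^ 2) (gaussianMixture E τ c).snd := by
  have hm : Measurable fun q : ℝ × E => Real.sqrt (c q.1) • q.2 := by fun_prop
  rw [snd_gaussianMixture hc, integrable_map_measure (by fun_prop) hm.aemeasurable]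
  exact (integrable_congr (sq_norm_sqrt_smul hc0)).2 (hci.mul_prod integrable_sq_norm_stdGaussian)

lemma integral_sq_norm_snd_gaussianMixture (hc : Measurable c) (hc0 : ∀ᵐ t ∂τ, 0 < c t) :
    ∫ y : E, ‖y‖ ^ 2 ∂(gaussianMixture E τ c).snd = Module.finrank ℝ E * ∫ t, c t ∂τ := by
  have hm : Measurable fun q : ℝ × E => Real.sqrt (c q.1) • q.2 := by fun_prop
  rw [snd_gaussianMixture hc, integral_map hm.aemeasurable (by fun_prop),
    integral_congr_ae (sq_norm_sqrt_smul hc0), integral_prod_mul c (fun z : E => ‖z‖ ^ 2),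
    integral_sq_norm_stdGaussian, mul_comm]

/-- The divergence of the joint law of `(T, √(c T) • Z)` from a product with a Gaussian law:
conditionally on `T` it is a divergence between two Gaussian laws. -/
lemma klDiv_gaussianMixture (hc : Measurable c) (hc0 : ∀ᵐ t ∂τ, 0 < c t)
    (hci : Integrable c τ) (hlog : Integrable (fun t => Real.log (c t)) τ) {w : ℝ} (hw : 0 < w) :
    klDiv (gaussianMixture E τ c) (τ.prod (gaussianLaw E w)) ≠ ∞ ∧
    (klDiv (gaussianMixture E τ c) (τ.prod (gaussianLaw E w))).toReal =
      (Module.finrank ℝ E : ℝ) / 2 *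
        (Real.log w - ∫ t, Real.log (c t) ∂τ - 1 + (∫ t, c t ∂τ) / w) := by
  set p : ℝ := (Module.finrank ℝ E : ℝ) with hp
  have := isProbabilityMeasure_gaussianMixture (E := E) (τ := τ) hc
  have hmf : Measurable fun q : ℝ × E => gaussianDensity (c q.1) q.2 :=
    measurable_gaussianDensity.comp ((hc.comp measurable_fst).prodMk measurable_snd)
  have hmg : Measurable fun q : ℝ × E => gaussianDensity w q.2 :=
    measurable_gaussianDensity.comp (measurable_const.prodMk measurable_snd)
  have hmw : Measurable fun y : E => gaussianDensity w y :=
    measurable_gaussianDensity.comp (measurable_const.prodMk measurable_id)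
  have hm := measurable_mixtureMap (E := E) hc
  -- the log-ratio of the densities, read in the coordinates `(T, Z)`
  set G : ℝ × E → ℝ := fun q => p / 2 * (Real.log w - Real.log (c q.1)) +
    (c q.1 * ‖q.2‖ ^ 2 / (2 * w) - 1 * (‖q.2‖ ^ 2 / 2)) with hG
  have hae : ((fun q : ℝ × E => Real.log (gaussianDensity (c q.1) q.2) -
      Real.log (gaussianDensity w q.2)) ∘ fun q => (q.1, Real.sqrt (c q.1) • q.2))
      =ᵐ[τ.prod (stdGaussian E)] G := by
    filter_upwards [Measure.quasiMeasurePreserving_fst.ae hc0, sq_norm_sqrt_smul hc0] with q hq h2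
    simp only [Function.comp_apply, hG]
    rw [log_gaussianDensity hq, log_gaussianDensity hw, h2, ← hp,
      Real.log_mul (by positivity) hq.ne', Real.log_mul (by positivity) hw.ne']
    field_simp
    ring
  have hi1 : Integrable (fun q : ℝ × E => p / 2 * (Real.log w - Real.log (c q.1)))
      (τ.prod (stdGaussian E)) :=
    (((integrable_const _).sub hlog).const_mul _).comp_fst _
  have hi2 : Integrable (fun q : ℝ × E => c q.1 * ‖q.2‖ ^ 2 / (2 * w))
      (τ.prod (stdGaussian E)) := (hci.mul_prod integrable_sq_norm_stdGaussian).div_const _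
  have hi3 : Integrable (fun q : ℝ × E => 1 * (‖q.2‖ ^ 2 / 2)) (τ.prod (stdGaussian E)) :=
    (integrable_const (1 : ℝ)).mul_prod (integrable_sq_norm_stdGaussian.div_const 2)
  have hi4 : Integrable (fun q : ℝ × E => c q.1 * ‖q.2‖ ^ 2 / (2 * w) - 1 * (‖q.2‖ ^ 2 / 2))
      (τ.prod (stdGaussian E)) := hi2.sub hi3
  have hiG : Integrable G (τ.prod (stdGaussian E)) := hi1.add hi4
  have hmeas : Measurable fun q : ℝ × E => Real.log (gaussianDensity (c q.1) q.2) -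
      Real.log (gaussianDensity w q.2) := hmf.log.sub hmg.log
  have hkl := klDiv_withDensity (m := τ.prod (volume : Measure E))
    (ρ := gaussianMixture E τ c) (τ := τ.prod (gaussianLaw E w)) hmf hmg
    (by filter_upwards [Measure.quasiMeasurePreserving_fst.ae hc0] with q hq
        exact gaussianDensity_pos hq q.2)
    (ae_of_all _ fun q => gaussianDensity_pos hw q.2)
    (gaussianMixture_eq_withDensity hc hc0)
    (by rw [← withDensity_gaussianDensity hw]; exact prod_withDensity_right hmw.ennreal_ofReal)
    (by rw [gaussianMixture, integrable_map_measure hmeas.aestronglyMeasurable hm.aemeasurable]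
        exact (integrable_congr hae).2 hiG)
  refine ⟨hkl.1, hkl.2.trans ?_⟩
  rw [gaussianMixture, integral_map hm.aemeasurable hmeas.aestronglyMeasurable]
  refine (integral_congr_ae hae).trans ?_
  rw [hG, integral_add hi1 hi4, integral_sub hi2 hi3, integral_div,
    integral_prod_mul c (fun z : E => ‖z‖ ^ 2),
    integral_prod_mul (fun _ : ℝ => (1 : ℝ)) (fun z : E => ‖z‖ ^ 2 / 2),
    integral_fun_fst (fun t => p / 2 * (Real.log w - Real.log (c t))), integral_const_mul,
    integral_sub (integrable_const _) hlog, integral_div, integral_sq_norm_stdGaussian, ← hp]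
  simp only [integral_const, probReal_univ, smul_eq_mul]
  field_simp
  ring

end Mixture

/-! ### Additive noise channels -/

section Channel

variable {E : Type*} [NormedAddCommGroup E] [InnerProductSpace ℝ E] [FiniteDimensional ℝ E]
  [MeasurableSpace E] [BorelSpace E]

/-- The law `ν` has the positive even density `f`, finite differential entropy and finite second
moment. -/
structure IsRegularNoise (ν : Measure E) (f : E → ℝ) : Prop where
  isProbabilityMeasure : IsProbabilityMeasure ν
  measurable : Measurable f
  pos : ∀ n, 0 < f n
  eq_withDensity : ν = volume.withDensity fun n => ENNReal.ofReal (f n)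
  even : ∀ n, f (-n) = f n
  integrable_log : Integrable (fun n => Real.log (f n)) ν
  integrable_sq_norm : Integrable (fun n => ‖n‖ ^ 2) ν

/-- The joint law of `(X, X + N)` for independent `X` and `N` with laws `μ` and `ν`. -/
def channelLaw (ν μ : Measure E) : Measure (E × E) :=
  (μ.prod ν).map fun q => (q.1, q.1 + q.2)

lemma fst_channelLaw (ν μ : Measure E) [IsProbabilityMeasure ν] [IsProbabilityMeasure μ] :
    (channelLaw ν μ).fst = μ := by
  rw [channelLaw, Measure.fst, Measure.map_map measurable_fst (by fun_prop)]
  change (μ.prod ν).fst = μ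
  exact Measure.fst_prod

lemma snd_channelLaw (ν μ : Measure E) : (channelLaw ν μ).snd = μ.conv ν := by
  rw [channelLaw, Measure.snd, Measure.map_map measurable_snd (by fun_prop)]
  rfl

instance isProbabilityMeasure_channelLaw (ν μ : Measure E) [IsProbabilityMeasure ν]
    [IsProbabilityMeasure μ] : IsProbabilityMeasure (channelLaw ν μ) :=
  Measure.isProbabilityMeasure_map (by fun_prop)

variable {ν : Measure E} {f : E → ℝ}

lemma IsRegularNoise.channelLaw_eq_withDensity (h : IsRegularNoise ν f) (μ : Measure E)
    [IsProbabilityMeasure μ] :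
    channelLaw ν μ = (μ.prod volume).withDensity fun q => ENNReal.ofReal (f (q.2 - q.1)) := by
  have hf := h.measurable
  have hT : Measurable fun q : E × E => (q.1, q.1 + q.2) := by fun_prop
  have hF : Measurable fun q : E × E => ENNReal.ofReal (f (q.2 - q.1)) := by fun_prop
  have hmp := measurePreserving_prod_add μ (volume : Measure E)
  ext S hS
  rw [channelLaw, Measure.map_apply hT hS, h.eq_withDensity,
    prod_withDensity_right hf.ennreal_ofReal, withDensity_apply _ (hT hS), withDensity_apply _ hS,
    ← hmp.setLIntegral_comp_preimage hS hF]
  simp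

lemma IsRegularNoise.measurePreserving_neg (h : IsRegularNoise ν f) :
    MeasurePreserving (fun n : E => -n) ν ν := by
  refine ⟨measurable_neg, ?_⟩
  have hmp := Measure.measurePreserving_neg (volume : Measure E)
  ext S hS
  rw [Measure.map_apply measurable_neg hS, h.eq_withDensity, withDensity_apply _ hS,
    withDensity_apply _ (measurable_neg hS),
    ← hmp.setLIntegral_comp_preimage hS h.measurable.ennreal_ofReal]
  simp_rw [h.even]

lemma integrable_sq_norm_add (h : IsRegularNoise ν f) {μ : Measure E} [IsProbabilityMeasure μ]
    (hμ : Integrable (fun x => ‖x‖ ^ 2) μ) :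
    Integrable (fun q : E × E => ‖q.1 + q.2‖ ^ 2) (μ.prod ν) := by
  have := h.isProbabilityMeasure
  refine Integrable.mono' (((hμ.comp_fst ν).add (h.integrable_sq_norm.comp_snd μ)).const_mul 2)
    (by fun_prop) (ae_of_all _ fun q => ?_)
  have h1 := parallelogram_law_with_norm ℝ q.1 q.2
  rw [Real.norm_of_nonneg (by positivity), Pi.add_apply]
  nlinarith [sq_nonneg ‖q.1 - q.2‖]

/-- Second moments add up. The noise is only used through its symmetry: the cross term disappears
in the parallelogram law. -/
lemma integral_sq_norm_add (h : IsRegularNoise ν f) {μ : Measure E} [IsProbabilityMeasure μ]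
    (hμ : Integrable (fun x => ‖x‖ ^ 2) μ) :
    ∫ q : E × E, ‖q.1 + q.2‖ ^ 2 ∂(μ.prod ν) = ∫ x, ‖x‖ ^ 2 ∂μ + ∫ n, ‖n‖ ^ 2 ∂ν := by
  have := h.isProbabilityMeasure
  have hi := integrable_sq_norm_add h hμ
  have hmp : MeasurePreserving (Prod.map id fun n : E => -n) (μ.prod ν) (μ.prod ν) :=
    (MeasurePreserving.id μ).prod h.measurePreserving_neg
  have hneg : ∫ q : E × E, ‖q.1 - q.2‖ ^ 2 ∂(μ.prod ν) =
      ∫ q : E × E, ‖q.1 + q.2‖ ^ 2 ∂(μ.prod ν) := by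
    have h1 := integral_map (μ := μ.prod ν) hmp.measurable.aemeasurable
      (f := fun q : E × E => ‖q.1 + q.2‖ ^ 2) (by fun_prop)
    rw [hmp.map_eq] at h1
    rw [h1]
    simp [sub_eq_add_neg]
  have hi' : Integrable (fun q : E × E => ‖q.1 - q.2‖ ^ 2) (μ.prod ν) := by
    have h1 := hmp.integrable_comp_of_integrable hi
    simpa [Function.comp_def, sub_eq_add_neg] using h1
  have hsum : ∫ q : E × E, (‖q.1 + q.2‖ ^ 2 + ‖q.1 - q.2‖ ^ 2) ∂(μ.prod ν) =
      2 * (∫ x, ‖x‖ ^ 2 ∂μ + ∫ n, ‖n‖ ^ 2 ∂ν) := by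
    have h1 : ∀ q : E × E, ‖q.1 + q.2‖ ^ 2 + ‖q.1 - q.2‖ ^ 2 = 2 * (‖q.1‖ ^ 2 + ‖q.2‖ ^ 2) := by
      intro q
      have := parallelogram_law_with_norm ℝ q.1 q.2
      linarith
    simp_rw [h1]
    rw [integral_const_mul, integral_add (hμ.comp_fst ν) (h.integrable_sq_norm.comp_snd μ),
      integral_fun_fst (fun x : E => ‖x‖ ^ 2), integral_fun_snd (fun x : E => ‖x‖ ^ 2)]
    simp
  rw [integral_add hi hi', hneg] at hsum
  linarith

lemma IsRegularNoise.integrable_negMulLog (h : IsRegularNoise ν f) :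
    Integrable fun n => Real.negMulLog (f n) := by
  have h1 := h.integrable_log
  rw [h.eq_withDensity, integrable_withDensity_iff_integrable_smul' h.measurable.ennreal_ofReal
    (by simp)] at h1
  refine h1.neg.congr (ae_of_all _ fun n => ?_)
  simp [ENNReal.toReal_ofReal (h.pos n).le, Real.negMulLog]

lemma IsRegularNoise.integral_log (h : IsRegularNoise ν f) :
    ∫ n, Real.log (f n) ∂ν = -differentialEntropy f := by
  rw [h.eq_withDensity, integral_withDensity_eq_integral_toReal_smul h.measurable.ennreal_ofReal
    (by simp), differentialEntropy, ← integral_neg]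
  congr 1 with n
  simp [ENNReal.toReal_ofReal (h.pos n).le, Real.negMulLog]

/-- The divergence of the joint law of input and output from a product with a Gaussian law. -/
lemma IsRegularNoise.klDiv_channelLaw (h : IsRegularNoise ν f) {μ : Measure E}
    [IsProbabilityMeasure μ] (hμ : Integrable (fun x => ‖x‖ ^ 2) μ) {w : ℝ} (hw : 0 < w) :
    klDiv (channelLaw ν μ) (μ.prod (gaussianLaw E w)) ≠ ∞ ∧
    (klDiv (channelLaw ν μ) (μ.prod (gaussianLaw E w))).toReal =
      (Module.finrank ℝ E : ℝ) / 2 * Real.log (2 * Real.pi * w) +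
        (∫ x, ‖x‖ ^ 2 ∂μ + ∫ n, ‖n‖ ^ 2 ∂ν) / (2 * w) - differentialEntropy f := by
  have := h.isProbabilityMeasure
  have hf := h.measurable
  set p : ℝ := (Module.finrank ℝ E : ℝ) with hp
  have hmf : Measurable fun q : E × E => f (q.2 - q.1) := by fun_prop
  have hmg : Measurable fun q : E × E => gaussianDensity w q.2 :=
    measurable_gaussianDensity.comp (measurable_const.prodMk measurable_snd)
  have hmw : Measurable fun y : E => gaussianDensity w y :=
    measurable_gaussianDensity.comp (measurable_const.prodMk measurable_id)
  have hT : Measurable fun q : E × E => (q.1, q.1 + q.2) := by fun_prop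
  have hmeas : Measurable fun q : E × E => Real.log (f (q.2 - q.1)) -
      Real.log (gaussianDensity w q.2) := hmf.log.sub hmg.log
  -- the log-ratio of the densities, read in the coordinates `(X, N)`
  have heq : ∀ q : E × E, Real.log (f ((q.1 + q.2) - q.1)) -
      Real.log (gaussianDensity w (q.1 + q.2)) = Real.log (f q.2) +
        (p / 2 * Real.log (2 * Real.pi * w) + ‖q.1 + q.2‖ ^ 2 / (2 * w)) := by
    intro q
    rw [log_gaussianDensity hw, add_sub_cancel_left]
    ring
  have hi1 : Integrable (fun q : E × E => Real.log (f q.2)) (μ.prod ν) :=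
    h.integrable_log.comp_snd μ
  have hi2 : Integrable (fun q : E × E => ‖q.1 + q.2‖ ^ 2 / (2 * w)) (μ.prod ν) :=
    (integrable_sq_norm_add h hμ).div_const _
  have hi3 : Integrable (fun q : E × E => p / 2 * Real.log (2 * Real.pi * w) +
      ‖q.1 + q.2‖ ^ 2 / (2 * w)) (μ.prod ν) := (integrable_const _).add hi2
  have hkl := klDiv_withDensity (m := μ.prod (volume : Measure E))
    (ρ := channelLaw ν μ) (τ := μ.prod (gaussianLaw E w)) hmf hmg
    (ae_of_all _ fun q => h.pos _)
    (ae_of_all _ fun q => gaussianDensity_pos hw q.2)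
    (h.channelLaw_eq_withDensity μ)
    (by rw [← withDensity_gaussianDensity hw]; exact prod_withDensity_right hmw.ennreal_ofReal)
    (by rw [channelLaw, integrable_map_measure hmeas.aestronglyMeasurable hT.aemeasurable]
        simp_rw [Function.comp_def, heq]
        exact hi1.add hi3)
  refine ⟨hkl.1, hkl.2.trans ?_⟩
  rw [channelLaw, integral_map hT.aemeasurable hmeas.aestronglyMeasurable]
  simp_rw [heq]
  rw [integral_add hi1 hi3, integral_add (integrable_const _) hi2, integral_div,
    integral_sq_norm_add h hμ, integral_fun_snd (fun n : E => Real.log (f n)), h.integral_log]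
  simp only [integral_const, probReal_univ, smul_eq_mul]
  ring

lemma IsRegularNoise.klDiv_gaussianLaw (h : IsRegularNoise ν f) {w : ℝ} (hw : 0 < w) :
    klDiv ν (gaussianLaw E w) ≠ ∞ ∧
    (klDiv ν (gaussianLaw E w)).toReal =
      (Module.finrank ℝ E : ℝ) / 2 * Real.log (2 * Real.pi * w) +
        (∫ n, ‖n‖ ^ 2 ∂ν) / (2 * w) - differentialEntropy f := by
  have := h.isProbabilityMeasure
  set p : ℝ := (Module.finrank ℝ E : ℝ) with hp
  have hmw : Measurable fun y : E => gaussianDensity w y :=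
    measurable_gaussianDensity.comp (measurable_const.prodMk measurable_id)
  have heq : ∀ n : E, Real.log (f n) - Real.log (gaussianDensity w n) = Real.log (f n) +
      (p / 2 * Real.log (2 * Real.pi * w) + ‖n‖ ^ 2 / (2 * w)) := by
    intro n
    rw [log_gaussianDensity hw]
    ring
  have hi2 : Integrable (fun n : E => ‖n‖ ^ 2 / (2 * w)) ν := h.integrable_sq_norm.div_const _
  have hi3 : Integrable (fun n : E => p / 2 * Real.log (2 * Real.pi * w) +
      ‖n‖ ^ 2 / (2 * w)) ν := (integrable_const _).add hi2
  have hkl := klDiv_withDensity (m := (volume : Measure E)) (ρ := ν) (τ := gaussianLaw E w)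
    h.measurable hmw (ae_of_all _ h.pos) (ae_of_all _ fun n => gaussianDensity_pos hw n)
    h.eq_withDensity (withDensity_gaussianDensity hw).symm
    (by simp_rw [heq]; exact h.integrable_log.add hi3)
  refine ⟨hkl.1, hkl.2.trans ?_⟩
  simp_rw [heq]
  rw [integral_add h.integrable_log hi3, integral_add (integrable_const _) hi2, integral_div,
    h.integral_log]
  simp only [integral_const, probReal_univ, smul_eq_mul]
  ring

/-- The golden formula for the channel, with a Gaussian reference law for the output. -/
lemma klDiv_channelLaw_eq_channelInfo_add (ν μ : Measure E) [IsProbabilityMeasure ν]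
    [IsProbabilityMeasure μ] (w : ℝ) :
    klDiv (channelLaw ν μ) (μ.prod (gaussianLaw E w)) =
      channelInfo ν μ + klDiv (μ.conv ν) (gaussianLaw E w) := by
  have h := klDiv_fst_prod_eq_mutualInfo_add (channelLaw ν μ) (gaussianLaw E w)
  rwa [fst_channelLaw, snd_channelLaw] at h

lemma IsRegularNoise.channelInfo_ne_top (h : IsRegularNoise ν f) {μ : Measure E}
    [IsProbabilityMeasure μ] (hμ : Integrable (fun x => ‖x‖ ^ 2) μ) : channelInfo ν μ ≠ ∞ := by
  have := h.isProbabilityMeasure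
  have h1 := (h.klDiv_channelLaw hμ one_pos).1
  rw [klDiv_channelLaw_eq_channelInfo_add] at h1
  exact (ENNReal.add_ne_top.1 h1).1

/-- The maximum-entropy bound: the Gaussian reference law is the one whose second moment is that of
the output. -/
lemma IsRegularNoise.toReal_channelInfo_le (h : IsRegularNoise ν f) {μ : Measure E}
    [IsProbabilityMeasure μ] (hμ : Integrable (fun x => ‖x‖ ^ 2) μ) {w : ℝ} (hw : 0 < w)
    (hle : ∫ x, ‖x‖ ^ 2 ∂μ + ∫ n, ‖n‖ ^ 2 ∂ν ≤ Module.finrank ℝ E * w) :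
    (channelInfo ν μ).toReal ≤
      (Module.finrank ℝ E : ℝ) / 2 * Real.log (2 * Real.pi * Real.exp 1 * w) -
        differentialEntropy f := by
  have := h.isProbabilityMeasure
  obtain ⟨h1, h2⟩ := h.klDiv_channelLaw hμ hw
  have h3 : (channelInfo ν μ).toReal ≤
      (klDiv (channelLaw ν μ) (μ.prod (gaussianLaw E w))).toReal := by
    refine ENNReal.toReal_mono h1 ?_
    rw [klDiv_channelLaw_eq_channelInfo_add]
    exact le_self_add
  have h4 : (∫ x, ‖x‖ ^ 2 ∂μ + ∫ n, ‖n‖ ^ 2 ∂ν) / (2 * w) ≤ (Module.finrank ℝ E : ℝ) / 2 := by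
    rw [div_le_div_iff₀ (by positivity) (by positivity)]
    linarith
  have h5 : Real.log (2 * Real.pi * Real.exp 1 * w) = Real.log (2 * Real.pi * w) + 1 := by
    rw [mul_right_comm, Real.log_mul (by positivity) (by positivity), Real.log_exp]
  rw [h5]
  linarith

/-! ### Noise given by a Gaussian scale mixture -/

variable {τ : Measure ℝ} [IsProbabilityMeasure τ] {c : ℝ → ℝ}

/-- The mutual information between the mixing variable and the noise is `h(N) - h(N | T)`. -/
lemma IsRegularNoise.mutualInfo_gaussianMixture (h : IsRegularNoise ν f)
    (hν : (gaussianMixture E τ c).snd = ν) (hc : Measurable c) (hc0 : ∀ᵐ t ∂τ, 0 < c t)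
    (hci : Integrable c τ) (hlog : Integrable (fun t => Real.log (c t)) τ) :
    mutualInfo (gaussianMixture E τ c) ≠ ∞ ∧
    (mutualInfo (gaussianMixture E τ c)).toReal = differentialEntropy f -
      (Module.finrank ℝ E : ℝ) / 2 *
        (Real.log (2 * Real.pi * Real.exp 1) + ∫ t, Real.log (c t) ∂τ) := by
  have := isProbabilityMeasure_gaussianMixture (E := E) (τ := τ) hc
  obtain ⟨h1, h2⟩ := klDiv_gaussianMixture (E := E) hc hc0 hci hlog one_pos
  obtain ⟨h3, h4⟩ := h.klDiv_gaussianLaw one_pos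
  have h5 := klDiv_fst_prod_eq_mutualInfo_add (gaussianMixture E τ c) (gaussianLaw E 1)
  rw [fst_gaussianMixture hc, hν] at h5
  have h6 : mutualInfo (gaussianMixture E τ c) ≠ ∞ := (ENNReal.add_ne_top.1 (h5 ▸ h1)).1
  refine ⟨h6, ?_⟩
  have h7 := congrArg ENNReal.toReal h5
  rw [ENNReal.toReal_add h6 h3, h2, h4, ← hν, integral_sq_norm_snd_gaussianMixture hc hc0] at h7
  have h8 : Real.log (2 * Real.pi * Real.exp 1) = Real.log (2 * Real.pi * 1) + 1 := by
    rw [Real.log_mul (by positivity) (by positivity), Real.log_exp, mul_one]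
  rw [h8]
  simp only [Real.log_one, div_one, mul_one] at h7 ⊢
  linarith

lemma integrable_log_add (hc0 : ∀ᵐ t ∂τ, 0 < c t) (hci : Integrable c τ)
    (hlog : Integrable (fun t => Real.log (c t)) τ) {v : ℝ} (hv : 0 ≤ v) :
    Integrable (fun t => Real.log (v + c t)) τ := by
  refine Integrable.mono' (hlog.abs.add ((integrable_const v).add hci))
    (by have := hci.aestronglyMeasurable.aemeasurable
        exact ((this.const_add v).log).aestronglyMeasurable) ?_
  filter_upwards [hc0] with t ht
  have h1 : Real.log (c t) ≤ Real.log (v + c t) := Real.log_le_log ht (by linarith)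
  have h2 := Real.log_le_sub_one_of_pos (show 0 < v + c t by linarith)
  have h3 := neg_abs_le (Real.log (c t))
  have h4 := abs_nonneg (Real.log (c t))
  simp only [Pi.add_apply, Real.norm_eq_abs]
  rw [abs_le]
  constructor <;> linarith

/-- The Gaussian-input bound: conditioning on the mixing variable decreases the entropy of the
output. In terms of divergences from a Gaussian law, the output is a marginal of the mixture with
variances `v + c T`, and divergence decreases under marginalization. -/
lemma IsRegularNoise.le_toReal_channelInfo_gaussianLaw (h : IsRegularNoise ν f)
    (hν : (gaussianMixture E τ c).snd = ν) (hc : Measurable c) (hc0 : ∀ᵐ t ∂τ, 0 < c t)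
    (hci : Integrable c τ) (hlog : Integrable (fun t => Real.log (c t)) τ) {v : ℝ} (hv : 0 ≤ v)
    (h2v : Integrable (fun x => ‖x‖ ^ 2) (gaussianLaw E v))
    (h2v' : ∫ x, ‖x‖ ^ 2 ∂(gaussianLaw E v) = Module.finrank ℝ E * v) :
    (Module.finrank ℝ E : ℝ) / 2 *
        (Real.log (2 * Real.pi * Real.exp 1) + ∫ t, Real.log (v + c t) ∂τ) -
        differentialEntropy f ≤
      (channelInfo ν (gaussianLaw E v)).toReal := by
  have := h.isProbabilityMeasure
  have hc' : Measurable fun t => v + c t := by fun_prop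
  have hc0' : ∀ᵐ t ∂τ, 0 < v + c t := hc0.mono fun t ht => by linarith
  have hci' : Integrable (fun t => v + c t) τ := (integrable_const v).add hci
  have := isProbabilityMeasure_gaussianMixture (E := E) (τ := τ) hc'
  obtain ⟨h1, h2⟩ := klDiv_gaussianMixture (E := E) hc' hc0' hci'
    (integrable_log_add hc0 hci hlog hv) one_pos
  obtain ⟨h3, h4⟩ := h.klDiv_channelLaw h2v one_pos
  have h5 := klDiv_channelLaw_eq_channelInfo_add ν (gaussianLaw E v) 1
  have h6 : klDiv ((gaussianLaw E v).conv ν) (gaussianLaw E 1) ≤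
      klDiv (gaussianMixture E τ fun t => v + c t) (τ.prod (gaussianLaw E 1)) := by
    have h7 := klDiv_map_le (gaussianMixture E τ fun t => v + c t) (τ.prod (gaussianLaw E 1))
      measurable_snd
    change klDiv (gaussianMixture E τ fun t => v + c t).snd (τ.prod (gaussianLaw E 1)).snd ≤ _
      at h7
    rwa [Measure.snd_prod, ← gaussianLaw_conv_snd_gaussianMixture hc (hc0.mono fun _ => le_of_lt)
      hv, hν] at h7
  have h7 := congrArg ENNReal.toReal h5
  rw [ENNReal.toReal_add (h.channelInfo_ne_top h2v) (ne_top_of_le_ne_top h1 h6), h4, h2v', ← hν,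
    integral_sq_norm_snd_gaussianMixture hc hc0, hν] at h7
  have h8 := ENNReal.toReal_mono h1 h6
  rw [h2, integral_add (integrable_const v) hci] at h8
  have h9 : Real.log (2 * Real.pi * Real.exp 1) = Real.log (2 * Real.pi * 1) + 1 := by
    rw [Real.log_mul (by positivity) (by positivity), Real.log_exp, mul_one]
  rw [h9]
  simp only [Real.log_one, div_one, mul_one, integral_const, probReal_univ, smul_eq_mul,
    one_mul] at h7 h8 ⊢
  linarith

end Channel

/-! ### The NDFHL noise -/

section Noise

variable {E : Type*} [NormedAddCommGroup E] [InnerProductSpace ℝ E] [FiniteDimensional ℝ E]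
  [MeasurableSpace E] [BorelSpace E]

lemma integrable_sq_norm_gaussianLaw (v : ℝ) :
    Integrable (fun x => ‖x‖ ^ 2) (gaussianLaw E v) := by
  rw [gaussianLaw, integrable_map_measure (by fun_prop) (by fun_prop)]
  simp_rw [Function.comp_def, norm_smul, mul_pow]
  exact integrable_sq_norm_stdGaussian.const_mul _

lemma integral_sq_norm_gaussianLaw {v : ℝ} (hv : 0 ≤ v) :
    ∫ x, ‖x‖ ^ 2 ∂(gaussianLaw E v) = Module.finrank ℝ E * v := by
  rw [gaussianLaw, integral_map (by fun_prop) (by fun_prop)]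
  simp_rw [norm_smul, mul_pow, Real.norm_of_nonneg (Real.sqrt_nonneg v), Real.sq_sqrt hv]
  rw [integral_const_mul, integral_sq_norm_stdGaussian, mul_comm]

variable {d : ℕ} {lam u σ : ℝ}

lemma isProbabilityMeasure_hittingTime (hlam : 0 < lam) (hu : 0 < u) (hσ : 0 < σ) :
    IsProbabilityMeasure (hittingTime lam u σ) :=
  isProbabilityMeasure_inverseGaussian (by positivity) (by positivity)

lemma ae_hittingTime_pos (lam u σ : ℝ) : ∀ᵐ t ∂(hittingTime lam u σ), 0 < t :=
  ae_inverseGaussian_pos _ _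

lemma integrable_log_hittingTime (hlam : 0 < lam) (hu : 0 < u) (hσ : 0 < σ) :
    Integrable Real.log (hittingTime lam u σ) :=
  integrable_log_inverseGaussian (by positivity) (by positivity)

lemma integrable_mul_hittingTime (hlam : 0 < lam) (hu : 0 < u) (hσ : 0 < σ) :
    Integrable (fun t => σ ^ 2 * t) (hittingTime lam u σ) :=
  (integrable_id_inverseGaussian (by positivity) (by positivity)).const_mul _

lemma integral_mul_hittingTime (hlam : 0 < lam) (hu : 0 < u) (hσ : 0 < σ) :
    ∫ t, σ ^ 2 * t ∂(hittingTime lam u σ) = lam / u := by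
  rw [integral_const_mul, hittingTime,
    integral_id_inverseGaussian (by positivity) (by positivity)]
  field_simp

lemma log_mul_hittingTime_ae (lam u : ℝ) (hσ : 0 < σ) :
    (fun t => Real.log (σ ^ 2 * t)) =ᵐ[hittingTime lam u σ]
      fun t => Real.log (σ ^ 2) + Real.log t := by
  filter_upwards [ae_hittingTime_pos lam u σ] with t ht
  rw [Real.log_mul (by positivity) ht.ne']

lemma mixture_eq_gaussianMixture (d : ℕ) (lam u : ℝ) (hσ : 0 < σ) :
    mixture d lam u σ =
      gaussianMixture (Plane d) (hittingTime lam u σ) fun t => σ ^ 2 * t := by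
  rw [mixture, gaussianMixture]
  congr 1 with q : 1
  rw [Real.sqrt_mul (sq_nonneg σ), Real.sqrt_sq hσ.le]

lemma snd_mixture (hd : 2 ≤ d) (hlam : 0 < lam) (hu : 0 < u) (hσ : 0 < σ) :
    (mixture d lam u σ).snd = law d lam u := by
  have := isProbabilityMeasure_hittingTime hlam hu hσ
  have hm : Measurable fun q : ℝ × Plane d =>
      ENNReal.ofReal (gaussianDensity (σ ^ 2 * q.1) q.2) :=
    (measurable_gaussianDensity.comp
      ((measurable_fst.const_mul _).prodMk measurable_snd)).ennreal_ofReal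
  rw [mixture_eq_gaussianMixture d lam u hσ, gaussianMixture_eq_withDensity (by fun_prop)
    ((ae_hittingTime_pos lam u σ).mono fun t ht => by positivity)]
  ext S hS
  rw [Measure.snd_apply hS, withDensity_apply _ (measurable_snd hS), law, withDensity_apply _ hS,
    ← Set.univ_prod, ← Measure.prod_restrict, Measure.restrict_univ,
    lintegral_prod_symm _ hm.aemeasurable]
  simp_rw [lintegral_gaussianDensity_hittingTime hd hlam hu hσ]

lemma isProbabilityMeasure_law (hd : 2 ≤ d) (hlam : 0 < lam) (hu : 0 < u) :
    IsProbabilityMeasure (law d lam u) := by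
  have := isProbabilityMeasure_hittingTime hlam hu one_pos
  have := isProbabilityMeasure_gaussianMixture (E := Plane d) (τ := hittingTime lam u 1)
    (c := fun t => 1 ^ 2 * t) (by fun_prop)
  rw [← snd_mixture hd hlam hu one_pos, mixture_eq_gaussianMixture d lam u one_pos]
  infer_instance

lemma integrable_sq_norm_law (hd : 2 ≤ d) (hlam : 0 < lam) (hu : 0 < u) :
    Integrable (fun n => ‖n‖ ^ 2) (law d lam u) := by
  have := isProbabilityMeasure_hittingTime hlam hu one_pos
  rw [← snd_mixture hd hlam hu one_pos, mixture_eq_gaussianMixture d lam u one_pos]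
  exact integrable_sq_norm_snd_gaussianMixture (by fun_prop)
    ((ae_hittingTime_pos lam u 1).mono fun t ht => by positivity)
    (integrable_mul_hittingTime hlam hu one_pos)

lemma integral_sq_norm_law (hd : 2 ≤ d) (hlam : 0 < lam) (hu : 0 < u) :
    ∫ n, ‖n‖ ^ 2 ∂(law d lam u) = ((d : ℝ) - 1) * (lam / u) := by
  have := isProbabilityMeasure_hittingTime hlam hu one_pos
  rw [← snd_mixture hd hlam hu one_pos, mixture_eq_gaussianMixture d lam u one_pos,
    integral_sq_norm_snd_gaussianMixture (by fun_prop)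
    ((ae_hittingTime_pos lam u 1).mono fun t ht => by positivity),
    integral_mul_hittingTime hlam hu one_pos, finrank_plane hd]

lemma isRegularNoise_law (hd : 2 ≤ d) (hlam : 0 < lam) (hu : 0 < u) :
    IsRegularNoise (law d lam u) (pdf d lam u) where
  isProbabilityMeasure := isProbabilityMeasure_law hd hlam hu
  measurable := measurable_pdf
  pos := pdf_pos hlam hu
  eq_withDensity := rfl
  even n := by simp [pdf]
  integrable_log := by
    have := isProbabilityMeasure_law hd hlam hu
    obtain ⟨A, B, hAB⟩ := exists_abs_log_pdf_le (d := d) hlam hu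
    exact Integrable.mono' ((integrable_const A).add
      ((integrable_sq_norm_law hd hlam hu).const_mul B))
      measurable_pdf.log.aestronglyMeasurable (ae_of_all _ hAB)
  integrable_sq_norm := integrable_sq_norm_law hd hlam hu

/-! ### Upper and lower bounds on the capacity -/

lemma isotropicGaussian_eq (d : ℕ) (v : ℝ) : isotropicGaussian d v = gaussianLaw (Plane d) v := rfl

lemma lintegral_sq_norm_isotropicGaussian (hd : 2 ≤ d) {P : ℝ} (hP : 0 < P) :
    ∫⁻ x, ENNReal.ofReal (‖x‖ ^ 2) ∂(isotropicGaussian d (P / ((d : ℝ) - 1))) =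
      ENNReal.ofReal P := by
  have hp := dimension_pos hd
  rw [isotropicGaussian_eq, ← ofReal_integral_eq_lintegral_ofReal
    (integrable_sq_norm_gaussianLaw _) (ae_of_all _ fun x => by positivity),
    integral_sq_norm_gaussianLaw (by positivity), finrank_plane hd]
  congr 1
  field_simp

lemma channelInfo_le_maxEntropyBound (hd : 2 ≤ d) (hlam : 0 < lam) (hu : 0 < u) {P : ℝ}
    (hP : 0 < P) {μ : Measure (Plane d)} [IsProbabilityMeasure μ]
    (hμ : ∫⁻ x, ENNReal.ofReal (‖x‖ ^ 2) ∂μ ≤ ENNReal.ofReal P) :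
    channelInfo (law d lam u) μ ≤ ENNReal.ofReal (maxEntropyBound d lam u P) := by
  have hp := dimension_pos hd
  have h := isRegularNoise_law hd hlam hu
  have hi : Integrable (fun x => ‖x‖ ^ 2) μ :=
    (lintegral_ofReal_ne_top_iff_integrable (by fun_prop) (ae_of_all _ fun x => by positivity)).1
      (ne_top_of_le_ne_top ENNReal.ofReal_ne_top hμ)
  have hle : ∫ x, ‖x‖ ^ 2 ∂μ ≤ P := by
    rwa [← ofReal_integral_eq_lintegral_ofReal hi (ae_of_all _ fun x => by positivity),
      ENNReal.ofReal_le_ofReal_iff hP.le] at hμ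
  have h1 := h.toReal_channelInfo_le hi (w := P / ((d : ℝ) - 1) + lam / u) (by positivity) (by
    rw [integral_sq_norm_law hd hlam hu, finrank_plane hd, mul_add, mul_div_cancel₀ _ hp.ne']
    linarith)
  rw [finrank_plane hd] at h1
  rw [← ENNReal.ofReal_toReal (h.channelInfo_ne_top hi)]
  exact ENNReal.ofReal_le_ofReal h1

lemma capacity_le_maxEntropyBound (hd : 2 ≤ d) (hlam : 0 < lam) (hu : 0 < u) {P : ℝ}
    (hP : 0 < P) :
    capacity (law d lam u) P ≤ ENNReal.ofReal (maxEntropyBound d lam u P) :=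
  iSup_le fun _ => iSup_le fun _ => iSup_le fun hμ =>
    channelInfo_le_maxEntropyBound hd hlam hu hP hμ

lemma channelInfo_isotropicGaussian_le_capacity (hd : 2 ≤ d) (lam u : ℝ) {P : ℝ} (hP : 0 < P) :
    channelInfo (law d lam u) (isotropicGaussian d (P / ((d : ℝ) - 1))) ≤
      capacity (law d lam u) P :=
  le_iSup_of_le _ (le_iSup_of_le (isProbabilityMeasure_gaussianLaw _)
    (le_iSup_of_le (lintegral_sq_norm_isotropicGaussian hd hP).le le_rfl))

lemma toReal_capacity_le_maxEntropyBound (hd : 2 ≤ d) (hlam : 0 < lam) (hu : 0 < u) {P : ℝ}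
    (hP : 0 < P) : (capacity (law d lam u) P).toReal ≤ maxEntropyBound d lam u P := by
  have h1 := ENNReal.toReal_mono ENNReal.ofReal_ne_top
    (capacity_le_maxEntropyBound (d := d) hd hlam hu hP)
  rcases le_or_gt 0 (maxEntropyBound d lam u P) with h0 | h0
  · rwa [ENNReal.toReal_ofReal h0] at h1
  · -- the bound is nonnegative, since it dominates a mutual information
    exfalso
    have h := isRegularNoise_law hd hlam hu
    have hp := dimension_pos hd
    have h2 := h.toReal_channelInfo_le (μ := gaussianLaw (Plane d) (P / ((d : ℝ) - 1)))
      (integrable_sq_norm_gaussianLaw _) (w := P / ((d : ℝ) - 1) + lam / u) (by positivity) (by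
        rw [integral_sq_norm_law hd hlam hu, integral_sq_norm_gaussianLaw (by positivity),
          finrank_plane hd, mul_add])
    rw [finrank_plane hd] at h2
    exact absurd (ENNReal.toReal_nonneg.trans h2) (not_le.2 h0)

lemma toReal_mutualInfo_mixture (hd : 2 ≤ d) (hlam : 0 < lam) (hu : 0 < u) (hσ : 0 < σ) :
    mutualInfo (mixture d lam u σ) ≠ ∞ ∧
    (mutualInfo (mixture d lam u σ)).toReal = differentialEntropy (pdf d lam u) -
      ((d : ℝ) - 1) / 2 * (Real.log (2 * Real.pi * Real.exp 1) + Real.log (σ ^ 2) +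
        ∫ t, Real.log t ∂(hittingTime lam u σ)) := by
  have := isProbabilityMeasure_hittingTime hlam hu hσ
  have hlog := integrable_log_hittingTime hlam hu hσ
  have hν := snd_mixture hd hlam hu hσ
  rw [mixture_eq_gaussianMixture d lam u hσ] at hν ⊢
  have h := (isRegularNoise_law hd hlam hu).mutualInfo_gaussianMixture hν (by fun_prop)
    ((ae_hittingTime_pos lam u σ).mono fun t ht => by positivity)
    (integrable_mul_hittingTime hlam hu hσ)
    ((integrable_congr (log_mul_hittingTime_ae lam u hσ)).2 ((integrable_const _).add hlog))
  refine ⟨h.1, h.2.trans ?_⟩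
  rw [integral_congr_ae (log_mul_hittingTime_ae lam u hσ), integral_add (integrable_const _) hlog,
    finrank_plane hd]
  simp [add_assoc]

lemma mixtureOffset_eq_offset (hd : 2 ≤ d) (hlam : 0 < lam) (hu : 0 < u) (hσ : 0 < σ) :
    mixtureOffset d lam u σ = offset d lam u := by
  have hp := dimension_pos hd
  rw [mixtureOffset, offset, (toReal_mutualInfo_mixture hd hlam hu hσ).2, Real.log_div one_ne_zero
    (by positivity), Real.log_mul hp.ne' (by positivity), Real.log_div (by positivity) hp.ne',
    Real.log_one]
  ring

lemma integrable_log_one_add_div (hd : 2 ≤ d) (hlam : 0 < lam) (hu : 0 < u) (hσ : 0 < σ) {P : ℝ}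
    (hP : 0 < P) :
    Integrable (fun t : ℝ => Real.log (1 + P / (((d : ℝ) - 1) * σ ^ 2 * t)))
      (hittingTime lam u σ) := by
  have hp := dimension_pos hd
  have hinv : Integrable (fun t => t⁻¹) (hittingTime lam u σ) :=
    integrable_inv_inverseGaussian (by positivity) (by positivity)
  refine Integrable.mono' (hinv.const_mul (P / (((d : ℝ) - 1) * σ ^ 2)))
    (Measurable.log (by fun_prop)).aestronglyMeasurable ?_
  filter_upwards [ae_hittingTime_pos lam u σ] with t ht
  have h0 : 0 < P / (((d : ℝ) - 1) * σ ^ 2 * t) := by positivity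
  have h1 := Real.log_le_sub_one_of_pos (show 0 < 1 + P / (((d : ℝ) - 1) * σ ^ 2 * t) by linarith)
  rw [Real.norm_of_nonneg (Real.log_nonneg (by linarith)), ← div_eq_mul_inv, div_div]
  linarith

lemma mixtureBound_le_channelInfo (hd : 2 ≤ d) (hlam : 0 < lam) (hu : 0 < u) (hσ : 0 < σ) {P : ℝ}
    (hP : 0 < P) :
    mixtureBound d lam u σ P ≤
      (channelInfo (law d lam u) (isotropicGaussian d (P / ((d : ℝ) - 1)))).toReal := by
  have hp := dimension_pos hd
  have := isProbabilityMeasure_hittingTime hlam hu hσ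
  have hlog := integrable_log_hittingTime hlam hu hσ
  have hν := snd_mixture hd hlam hu hσ
  rw [mixture_eq_gaussianMixture d lam u hσ] at hν
  set v : ℝ := P / ((d : ℝ) - 1) with hv
  have hv0 : 0 < v := by positivity
  have hc0 : ∀ᵐ t ∂(hittingTime lam u σ), 0 < σ ^ 2 * t :=
    (ae_hittingTime_pos lam u σ).mono fun t ht => by positivity
  have hci := integrable_mul_hittingTime hlam hu hσ
  have hclog : Integrable (fun t => Real.log (σ ^ 2 * t)) (hittingTime lam u σ) :=
    (integrable_congr (log_mul_hittingTime_ae lam u hσ)).2 ((integrable_const _).add hlog)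
  have h := (isRegularNoise_law hd hlam hu).le_toReal_channelInfo_gaussianLaw hν (by fun_prop)
    hc0 hci hclog hv0.le (integrable_sq_norm_gaussianLaw v) (integral_sq_norm_gaussianLaw hv0.le)
  have hsplit : (fun t : ℝ => ((d : ℝ) - 1) / 2 *
      Real.log (1 + P / (((d : ℝ) - 1) * σ ^ 2 * t))) =ᵐ[hittingTime lam u σ]
      fun t => ((d : ℝ) - 1) / 2 * (Real.log (v + σ ^ 2 * t) - Real.log (σ ^ 2 * t)) := by
    filter_upwards [hc0] with t ht
    rw [← Real.log_div (by positivity) ht.ne']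
    congr 2
    rw [add_div, div_self ht.ne', hv, div_div, add_comm, mul_assoc]
  rw [isotropicGaussian_eq]
  refine le_trans (le_of_eq ?_) h
  rw [mixtureBound, integral_congr_ae hsplit, integral_const_mul,
    integral_sub (integrable_log_add hc0 hci hclog hv0.le) hclog,
    (toReal_mutualInfo_mixture hd hlam hu hσ).2,
    integral_congr_ae (log_mul_hittingTime_ae lam u hσ), integral_add (integrable_const _) hlog,
    finrank_plane hd]
  simp only [integral_const, probReal_univ, smul_eq_mul, one_mul]
  ring

lemma capacity_ne_top (hd : 2 ≤ d) (hlam : 0 < lam) (hu : 0 < u) {P : ℝ} (hP : 0 < P) :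
    capacity (law d lam u) P ≠ ∞ :=
  ne_top_of_le_ne_top ENNReal.ofReal_ne_top (capacity_le_maxEntropyBound hd hlam hu hP)

lemma toReal_channelInfo_isotropicGaussian_le (hd : 2 ≤ d) (hlam : 0 < lam) (hu : 0 < u) {P : ℝ}
    (hP : 0 < P) :
    (channelInfo (law d lam u) (isotropicGaussian d (P / ((d : ℝ) - 1)))).toReal ≤
      (capacity (law d lam u) P).toReal :=
  ENNReal.toReal_mono (capacity_ne_top hd hlam hu hP)
    (channelInfo_isotropicGaussian_le_capacity hd lam u hP)

/-! ### High-power asymptotics -/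

lemma tendsto_maxEntropyBound (hd : 2 ≤ d) (hlam : 0 < lam) (hu : 0 < u) :
    Tendsto (fun P : ℝ => maxEntropyBound d lam u P - ((d : ℝ) - 1) / 2 * Real.log P)
      atTop (𝓝 (offset d lam u)) := by
  have hp := dimension_pos hd
  set a : ℝ := 2 * Real.pi * Real.exp 1 with ha
  have ha0 : 0 < a := by positivity
  have h1 : Tendsto (fun P : ℝ => a * (1 / ((d : ℝ) - 1) + lam / u * P⁻¹)) atTop
      (𝓝 (a / ((d : ℝ) - 1))) := by
    have h2 := ((tendsto_inv_atTop_zero (𝕜 := ℝ)).const_mul (lam / u)).const_add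
      (1 / ((d : ℝ) - 1)) |>.const_mul a
    convert h2 using 2
    ring
  have h2 := ((h1.log (by positivity)).const_mul (((d : ℝ) - 1) / 2)).sub_const
    (differentialEntropy (pdf d lam u))
  refine h2.congr' ?_
  filter_upwards [eventually_gt_atTop 0] with P hP
  have h3 : a * (1 / ((d : ℝ) - 1) + lam / u * P⁻¹) =
      a * (P / ((d : ℝ) - 1) + lam / u) / P := by
    field_simp
  rw [maxEntropyBound, h3, Real.log_div (by positivity) hP.ne']
  ring

lemma tendsto_mixtureBound (hd : 2 ≤ d) (hlam : 0 < lam) (hu : 0 < u) (hσ : 0 < σ) :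
    Tendsto (fun P : ℝ => mixtureBound d lam u σ P - ((d : ℝ) - 1) / 2 * Real.log P)
      atTop (𝓝 (mixtureOffset d lam u σ)) := by
  have hp := dimension_pos hd
  have := isProbabilityMeasure_hittingTime hlam hu hσ
  have hlog := integrable_log_hittingTime hlam hu hσ
  set τ := hittingTime lam u σ with hτ
  set b : ℝ := ((d : ℝ) - 1) * σ ^ 2 with hb
  have hb0 : 0 < b := by positivity
  have hpos := ae_hittingTime_pos lam u σ
  have hlim : (fun t => Real.log (1 / b) - Real.log t) =ᵐ[τ] fun t => Real.log (1 / (b * t)) := by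
    filter_upwards [hpos] with t ht
    rw [← Real.log_div (by positivity) ht.ne', div_div]
  have hlimi : Integrable (fun t => Real.log (1 / (b * t))) τ :=
    (integrable_congr hlim).1 ((integrable_const _).sub hlog)
  have h1i : Integrable (fun t => Real.log (1 + 1 / (b * t))) τ :=
    integrable_log_one_add_div hd hlam hu hσ one_pos
  -- `log (1 + P / (b t)) - log P = log (1 / P + 1 / (b t))`, which is monotone in `P`
  have hdom : Tendsto (fun P : ℝ => ∫ t, Real.log (P⁻¹ + 1 / (b * t)) ∂τ) atTop
      (𝓝 (∫ t, Real.log (1 / (b * t)) ∂τ)) := by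
    refine tendsto_integral_filter_of_dominated_convergence
      (fun t => |Real.log (1 / (b * t))| + |Real.log (1 + 1 / (b * t))|)
      (Eventually.of_forall fun P => (Measurable.log (by fun_prop)).aestronglyMeasurable) ?_ (hlimi.abs.add h1i.abs) ?_
    · filter_upwards [eventually_ge_atTop 1] with P hP
      filter_upwards [hpos] with t ht
      have e0 : 0 < 1 / (b * t) := by positivity
      have e1 : 0 < P⁻¹ := by positivity
      have e2 : P⁻¹ ≤ 1 := inv_le_one_of_one_le₀ hP
      have e3 : Real.log (1 / (b * t)) ≤ Real.log (P⁻¹ + 1 / (b * t)) :=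
        Real.log_le_log e0 (by linarith)
      have e4 : Real.log (P⁻¹ + 1 / (b * t)) ≤ Real.log (1 + 1 / (b * t)) :=
        Real.log_le_log (by linarith) (by linarith)
      rw [Real.norm_eq_abs]
      exact (abs_le_max_abs_abs e3 e4).trans (max_le_add_of_nonneg (abs_nonneg _) (abs_nonneg _))
    · filter_upwards [hpos] with t ht
      have e0 : 0 < 1 / (b * t) := by positivity
      have h := (tendsto_inv_atTop_zero (𝕜 := ℝ)).add_const (1 / (b * t))
      rw [zero_add] at h
      exact h.log e0.ne'
  have h2 := (hdom.const_mul (((d : ℝ) - 1) / 2)).sub_const (mutualInfo (mixture d lam u σ)).toReal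
  have h3 : mixtureOffset d lam u σ = ((d : ℝ) - 1) / 2 * ∫ t, Real.log (1 / (b * t)) ∂τ -
      (mutualInfo (mixture d lam u σ)).toReal := by
    rw [mixtureOffset, ← integral_congr_ae hlim, integral_sub (integrable_const _) hlog]
    simp only [integral_const, probReal_univ, smul_eq_mul, one_mul]
    ring
  rw [h3]
  refine h2.congr' ?_
  filter_upwards [eventually_gt_atTop 0] with P hP
  have h4 : (fun t => Real.log (P⁻¹ + 1 / (b * t))) =ᵐ[τ]
      fun t => Real.log (1 + P / (b * t)) - Real.log P := by
    filter_upwards [hpos] with t ht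
    rw [← Real.log_div (by positivity) hP.ne']
    congr 1
    field_simp
  rw [mixtureBound, integral_congr_ae h4, integral_sub
    (integrable_log_one_add_div hd hlam hu hσ hP) (integrable_const _), integral_const_mul]
  simp only [integral_const, probReal_univ, smul_eq_mul, one_mul]
  ring

lemma tendsto_channelInfo_isotropicGaussian (hd : 2 ≤ d) (hlam : 0 < lam) (hu : 0 < u) :
    Tendsto (fun P : ℝ => (channelInfo (law d lam u)
        (isotropicGaussian d (P / ((d : ℝ) - 1)))).toReal - ((d : ℝ) - 1) / 2 * Real.log P)
      atTop (𝓝 (offset d lam u)) := by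
  have hlower := tendsto_mixtureBound hd hlam hu one_pos
  rw [mixtureOffset_eq_offset hd hlam hu one_pos] at hlower
  refine tendsto_of_tendsto_of_tendsto_of_le_of_le' hlower
    (tendsto_maxEntropyBound hd hlam hu) ?_ ?_
  · filter_upwards [eventually_gt_atTop 0] with P hP
    linarith [mixtureBound_le_channelInfo hd hlam hu one_pos hP]
  · filter_upwards [eventually_gt_atTop 0] with P hP
    linarith [toReal_channelInfo_isotropicGaussian_le hd hlam hu hP,
      toReal_capacity_le_maxEntropyBound hd hlam hu hP]

lemma tendsto_capacity (hd : 2 ≤ d) (hlam : 0 < lam) (hu : 0 < u) :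
    Tendsto (fun P : ℝ => (capacity (law d lam u) P).toReal - ((d : ℝ) - 1) / 2 * Real.log P)
      atTop (𝓝 (offset d lam u)) := by
  refine tendsto_of_tendsto_of_tendsto_of_le_of_le'
    (tendsto_channelInfo_isotropicGaussian hd hlam hu) (tendsto_maxEntropyBound hd hlam hu) ?_ ?_
  · filter_upwards [eventually_gt_atTop 0] with P hP
    linarith [toReal_channelInfo_isotropicGaussian_le hd hlam hu hP]
  · filter_upwards [eventually_gt_atTop 0] with P hP
    linarith [toReal_capacity_le_maxEntropyBound hd hlam hu hP]

end Noise

end NDFHL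

end

theorem mainTheorem1 (d : ℕ) (hd : 2 ≤ d) (lam u : ℝ) (hlam : 0 < lam) (hu : 0 < u) :
    -- the noise law is a probability law and its differential entropy is finite
    IsProbabilityMeasure (NDFHL.law d lam u) ∧
    Integrable (fun n => Real.negMulLog (NDFHL.pdf d lam u n)) volume ∧
    -- the capacity is finite and has the expansion `(p/2) log P + c* + o(1)`
    (∀ P : ℝ, 0 < P → NDFHL.capacity (NDFHL.law d lam u) P ≠ ∞) ∧
    Tendsto (fun P : ℝ => (NDFHL.capacity (NDFHL.law d lam u) P).toReal -
        ((d : ℝ) - 1) / 2 * Real.log P)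
      atTop (𝓝 (NDFHL.offset d lam u)) ∧
    -- the maximum-entropy upper bound, and its constant term
    (∀ P : ℝ, 0 < P →
      (NDFHL.capacity (NDFHL.law d lam u) P).toReal ≤ NDFHL.maxEntropyBound d lam u P) ∧
    Tendsto (fun P : ℝ => NDFHL.maxEntropyBound d lam u P - ((d : ℝ) - 1) / 2 * Real.log P)
      atTop (𝓝 (NDFHL.offset d lam u)) ∧
    -- the Gaussian-input lower bound from the inverse Gaussian mixture, and its constant term
    (∀ σ : ℝ, 0 < σ →
      IsProbabilityMeasure (NDFHL.hittingTime lam u σ) ∧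
      (NDFHL.mixture d lam u σ).snd = NDFHL.law d lam u ∧
      Integrable Real.log (NDFHL.hittingTime lam u σ) ∧
      NDFHL.mutualInfo (NDFHL.mixture d lam u σ) ≠ ∞ ∧
      (∀ P : ℝ, 0 < P →
        Integrable (fun t : ℝ => Real.log (1 + P / (((d : ℝ) - 1) * σ ^ 2 * t)))
          (NDFHL.hittingTime lam u σ) ∧
        NDFHL.mixtureBound d lam u σ P ≤
          (NDFHL.channelInfo (NDFHL.law d lam u)
            (NDFHL.isotropicGaussian d (P / ((d : ℝ) - 1)))).toReal) ∧
      Tendsto (fun P : ℝ => NDFHL.mixtureBound d lam u σ P - ((d : ℝ) - 1) / 2 * Real.log P)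
        atTop (𝓝 (NDFHL.mixtureOffset d lam u σ)) ∧
      NDFHL.mixtureOffset d lam u σ = NDFHL.offset d lam u) ∧
    -- the isotropic Gaussian input is admissible and asymptotically optimal
    (∀ P : ℝ, 0 < P →
      IsProbabilityMeasure (NDFHL.isotropicGaussian d (P / ((d : ℝ) - 1))) ∧
      ∫⁻ x, ENNReal.ofReal (‖x‖ ^ 2) ∂(NDFHL.isotropicGaussian d (P / ((d : ℝ) - 1))) =
        ENNReal.ofReal P ∧
      NDFHL.channelInfo (NDFHL.law d lam u)
        (NDFHL.isotropicGaussian d (P / ((d : ℝ) - 1))) ≠ ∞) ∧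
    Tendsto (fun P : ℝ => (NDFHL.capacity (NDFHL.law d lam u) P).toReal -
        (NDFHL.channelInfo (NDFHL.law d lam u)
          (NDFHL.isotropicGaussian d (P / ((d : ℝ) - 1)))).toReal)
      atTop (𝓝 0) := by
  have hreg := NDFHL.isRegularNoise_law hd hlam hu
  have hG : ∀ v : ℝ, IsProbabilityMeasure (NDFHL.isotropicGaussian d v) :=
    NDFHL.isProbabilityMeasure_gaussianLaw
  refine ⟨hreg.isProbabilityMeasure, hreg.integrable_negMulLog,
    fun P hP => NDFHL.capacity_ne_top hd hlam hu hP, NDFHL.tendsto_capacity hd hlam hu,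
    fun P hP => NDFHL.toReal_capacity_le_maxEntropyBound hd hlam hu hP,
    NDFHL.tendsto_maxEntropyBound hd hlam hu,
    fun σ hσ => ⟨NDFHL.isProbabilityMeasure_hittingTime hlam hu hσ,
      NDFHL.snd_mixture hd hlam hu hσ, NDFHL.integrable_log_hittingTime hlam hu hσ,
      (NDFHL.toReal_mutualInfo_mixture hd hlam hu hσ).1,
      fun P hP => ⟨NDFHL.integrable_log_one_add_div hd hlam hu hσ hP,
        NDFHL.mixtureBound_le_channelInfo hd hlam hu hσ hP⟩,
      NDFHL.tendsto_mixtureBound hd hlam hu hσ, NDFHL.mixtureOffset_eq_offset hd hlam hu hσ⟩,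
    fun P hP => ⟨hG _, NDFHL.lintegral_sq_norm_isotropicGaussian hd hP,
      hreg.channelInfo_ne_top (NDFHL.integrable_sq_norm_gaussianLaw _)⟩, ?_⟩
  have h := (NDFHL.tendsto_capacity hd hlam hu).sub
    (NDFHL.tendsto_channelInfo_isotropicGaussian hd hlam hu)
  rw [sub_self] at h
  exact h.congr fun P => by ring
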